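/- Let $\mathcal X\subset\mathbb R^d$ be a finite set of arms, let $R>0$, $\mathcal E=\{\theta\in\mathbb R^d:\|\theta\|_2\le R\}$, $\theta_*\in\mathcal E$, and let $x_*\in\arg\max_{x\in\mathcal X}\langle\theta_*,x\rangle$. In round $t=0,1,2,\dots$ a learner pulls an arm $x_t\in\mathcal X$, chosen from the past rewards and internal randomness, and observes $y_t=\langle\theta,x_t\rangle+\xi_t$, where $\theta\in\mathcal E$ is unknown and the $\xi_t$ are i.i.d. $\mathcal N(0,1)$, independent of the internal randomness. The learner stops after a number of samples $\tau$ (possibly $0$ or $\infty$) decided by the data observed so far and its internal randomness, and then returns an arm $\widehat x\in\mathcal X$. The strategy is $\delta$-correct if $\mathbb P_\theta(\tau<\infty,\ \widehat x\ne x_*(\theta))\le\delta$ for every $\theta\in\mathcal E$ that has a unique best arm $x_*(\theta)$; this holds in particular if for every such $\theta$ it stops and returns the best arm with probability at least $1-\delta$. For $\lambda$ in the simplex $\Delta_{\mathcal X}$ put $A(\lambda)=\sum_{x\in\mathcal X}\lambda_x xx^\top$, write $\|v\|_M^2=v^\top Mv$, and define the characteristic time $T^*(\theta_*)\in[0,\infty]$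 by $$T^*(\theta_*)^{-1}=\max_{\lambda\in\Delta_{\mathcal X}}\ \inf\Big\{\tfrac12\|\theta-\theta_*\|^2_{A(\lambda)}\ :\ \theta\in\mathcal E,\ \exists\,x'\in\mathcal X\setminus\{x_*\},\ \theta^\top(x'-x_*)>0\Big\}$$ (with $\inf\emptyset=\infty$, $0^{-1}=\infty$, $\infty^{-1}=0$). Then this maximum is attained, and: (i) $$T^*(\theta_*)^{-1}=\max_{\lambda\in\Delta_{\mathcal X}}\ \inf_{x'\in\mathcal X\setminus\{x_*\}}\ \sup_{\gamma\ge 0}F(\lambda,x',\gamma,\theta_*),$$ where the maximum is attained, the supremum is over those $\gamma\ge0$ for which $A(\lambda)+\gamma I$ is invertible (all $\gamma>0$, and $\gamma=0$ if $A(\lambda)$ is invertible), and $$F(\lambda,x',\gamma,\theta_*)=\frac{\max\{(x_*-x')^\top(A(\lambda)+\gamma I)^{-1}A(\lambda)\theta_*,\,0\}^2}{2\,\|x'-x_*\|^2_{(A(\lambda)+\gamma I)^{-1}}}+\frac{\gamma}{2}\Big(\|\theta_*\|^2_{(A(\lambda)+\gamma I)^{-1}A(\lambda)}-R^2\Big).$$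 (ii) For every family of strategies, one $\delta$-correct strategy for each $\delta\in(0,1)$, with numbers of samples $\tau_\delta$, $$\liminf_{\delta\to0^+}\frac{\mathbb E_{\theta_*}[\tau_\delta]}{\log(1/\delta)}\ \ge\ T^*(\theta_*).$$ -/

import Mathlib

open MeasureTheory ProbabilityTheory Filter Topology
open scoped ENNReal Matrix

namespace LinBandit

/-! ### The interaction protocol -/

/-- A (possibly randomized) pure-exploration strategy on the finite arm set `X`.
All internal randomness is a seed in `S`, drawn before the game starts; after `t` rewards the
data available to the learner is the seed and the rewards `y₀, …, y_{t-1}` (these determine the arms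
pulled so far). `arm t` is the arm pulled next, `haltSet t` is the set of data on which the learner
is willing to stop after `t` samples, and `answer t` is the arm returned when stopping then. -/
structure Strategy {d : ℕ} (X : Finset (EuclideanSpace ℝ (Fin d)))
    (S : Type*) [MeasurableSpace S] where
  arm : (t : ℕ) → S × (Fin t → ℝ) → X
  measurable_arm : ∀ t, Measurable (arm t)
  haltSet : (t : ℕ) → Set (S × (Fin t → ℝ))
  measurableSet_haltSet : ∀ t, MeasurableSet (haltSet t)
  answer : (t : ℕ) → S × (Fin t → ℝ) → X
  measurable_answer : ∀ t, Measurable (answer t)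

section Protocol

variable {d : ℕ} {X : Finset (EuclideanSpace ℝ (Fin d))} {S : Type*} [MeasurableSpace S]

/-- The rewards `y₀, …, y_{t-1}` when the parameter is `θ`, the seed is `ω.1` and the noise sequence
is `ω.2`: the reward of round `t` is `⟪θ, x_t⟫ + ξ_t`, with `x_t` the arm pulled. -/
noncomputable def Strategy.rewards (a : Strategy X S) (θ : EuclideanSpace ℝ (Fin d))
    (ω : S × (ℕ → ℝ)) : (t : ℕ) → (Fin t → ℝ)
  | 0 => Fin.elim0
  | t + 1 => Fin.snoc (a.rewards θ ω t)
      (inner ℝ θ (a.arm t (ω.1, a.rewards θ ω t) : EuclideanSpace ℝ (Fin d)) + ω.2 t)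

/-- The number of samples used: the first time the stopping rule is met (`⊤` if it never is). -/
noncomputable def Strategy.stopTime (a : Strategy X S) (θ : EuclideanSpace ℝ (Fin d))
    (ω : S × (ℕ → ℝ)) : ℕ∞ :=
  ⨅ (t : ℕ) (_ : (ω.1, a.rewards θ ω t) ∈ a.haltSet t), (t : ℕ∞)

/-- The law of the seed and of the i.i.d. standard Gaussian noise, which are independent. -/
noncomputable def noiseLaw (ν : Measure S) : Measure (S × (ℕ → ℝ)) :=
  ν.prod (Measure.infinitePi fun _ : ℕ => gaussianReal 0 1)

/-- The expected number of samples under the parameter `θ`. -/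
noncomputable def Strategy.expectedSamples (a : Strategy X S) (ν : Measure S)
    (θ : EuclideanSpace ℝ (Fin d)) : ℝ≥0∞ :=
  ∫⁻ ω, (a.stopTime θ ω : ℝ≥0∞) ∂(noiseLaw ν)

/-- `x` is the unique best arm under the parameter `θ`. -/
def IsUniqueBest (X : Finset (EuclideanSpace ℝ (Fin d))) (θ x : EuclideanSpace ℝ (Fin d)) : Prop :=
  x ∈ X ∧ ∀ x' ∈ X, x' ≠ x → inner ℝ θ x' < inner ℝ θ x

/-- `δ`-correctness on the class `‖θ‖₂ ≤ R`: under every parameter of the class for which the best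
arm is well defined, the probability of stopping with a wrong arm is at most `δ`. In particular
every strategy that stops and returns the best arm with probability at least `1 - δ` under each such
parameter is `δ`-correct. -/
def Strategy.IsDeltaCorrect (a : Strategy X S) (ν : Measure S) (R δ : ℝ) : Prop :=
  ∀ θ : EuclideanSpace ℝ (Fin d), ‖θ‖ ≤ R → ∀ x, IsUniqueBest X θ x →
    noiseLaw ν {ω | ∃ t : ℕ, a.stopTime θ ω = t ∧
      (a.answer t (ω.1, a.rewards θ ω t) : EuclideanSpace ℝ (Fin d)) ≠ x} ≤ ENNReal.ofReal δ

end Protocol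

/-! ### The characteristic time -/

section CharTime

variable {d : ℕ} (X : Finset (EuclideanSpace ℝ (Fin d)))

/-- The design matrix `A(w) = ∑ₓ wₓ x xᵀ`. -/
noncomputable def designMatrix (w : X → ℝ) : Matrix (Fin d) (Fin d) ℝ :=
  ∑ x : X, w x • Matrix.vecMulVec (x : EuclideanSpace ℝ (Fin d)).ofLp
    (x : EuclideanSpace ℝ (Fin d)).ofLp

/-- The bilinear form `uᵀ M v`; `quad M v v` is `‖v‖²_M`. -/
noncomputable def quad (M : Matrix (Fin d) (Fin d) ℝ) (u v : EuclideanSpace ℝ (Fin d)) : ℝ :=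
  u.ofLp ⬝ᵥ (M *ᵥ v.ofLp)

/-- The parameters of the class `‖θ‖₂ ≤ R` under which some arm is strictly better than `xs`. -/
def alternatives (R : ℝ) (xs : EuclideanSpace ℝ (Fin d)) : Set (EuclideanSpace ℝ (Fin d)) :=
  {θ | ‖θ‖ ≤ R ∧ ∃ x' ∈ X, x' ≠ xs ∧ 0 < (inner ℝ θ (x' - xs) : ℝ)}

/-- `inf` over the alternatives `θ` of `½ ‖θ - θs‖²_{A(w)}` (`∞` if there is no alternative). -/
noncomputable def primalValue (R : ℝ) (θs xs : EuclideanSpace ℝ (Fin d)) (w : X → ℝ) : ℝ≥0∞ :=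
  ⨅ θ ∈ alternatives X R xs,
    ENNReal.ofReal (1 / 2 * quad (designMatrix X w) (θ - θs) (θ - θs))

/-- The characteristic time `T*(θs)`; its inverse is
`sup_w inf_θ ½ ‖θ - θs‖²_{A(w)}`, with `w` in the simplex and `θ` an alternative. -/
noncomputable def charTime (R : ℝ) (θs xs : EuclideanSpace ℝ (Fin d)) : ℝ≥0∞ :=
  (⨆ w ∈ stdSimplex ℝ X, primalValue X R θs xs w)⁻¹

/-- The dual function `F(w, x', γ, θs)`. -/
noncomputable def dualF (R : ℝ) (θs xs : EuclideanSpace ℝ (Fin d)) (w : X → ℝ)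
    (x' : EuclideanSpace ℝ (Fin d)) (γ : ℝ) : ℝ :=
  let A := designMatrix X w
  let M := A + γ • (1 : Matrix (Fin d) (Fin d) ℝ)
  (max (quad (M⁻¹ * A) (xs - x') θs) 0) ^ 2 / (2 * quad M⁻¹ (x' - xs) (x' - xs))
    + γ / 2 * (quad (M⁻¹ * A) θs θs - R ^ 2)

/-- The multipliers `γ ≥ 0` for which `A(w) + γ I` is invertible: all `γ > 0`, and also
`γ = 0` if `A(w)` is invertible. -/
def multipliers (w : X → ℝ) : Set ℝ :=
  {γ | 0 ≤ γ ∧ IsUnit (designMatrix X w + γ • (1 : Matrix (Fin d) (Fin d) ℝ))}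

/-- `inf_{x' ≠ xs} sup_γ F(w, x', γ, θs)`, in the extended reals. -/
noncomputable def dualValue (R : ℝ) (θs xs : EuclideanSpace ℝ (Fin d)) (w : X → ℝ) : EReal :=
  ⨅ x' ∈ {x' | x' ∈ X ∧ x' ≠ xs}, ⨆ γ ∈ multipliers X w, (dualF X R θs xs w x' γ : EReal)

end CharTime

end LinBandit

/-! For the lower bound, compare the true parameter `θs` with an alternative `θ'` whose unique best
arm `z` is not `xs`. A strategy with finite expected sample size stops almost surely. If `xs` is the
unique best arm under `θs`, then with probability at least `1 - δ` it stops with an arm other than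
`z`, an event of probability at most `δ` under `θ'`. The variational inequality `E[φ] ≤ KL + log
E'[exp φ]`, with `φ` equal to `log (1/δ)` on the rare event and `0` elsewhere, bounds `(1 - δ) log
(1/δ) - log 2` by the Kullback-Leibler divergence, that is `½ ∑ₓ E[Nₓ] ⟪θ' - θs, x⟫²` with `Nₓ` the
number of pulls of `x` before stopping (`log_mul_measureReal_le`, `log_mul_stop_le`). To count only
those pulls, `θ'` is replaced by a drift that switches back to `θs` at the stopping time.

Parameters with a unique best arm are dense and the divergence is continuous in the parameter, so
the bound reaches every alternative (`le_information`). Normalizing the expected pulls gives a point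
of the simplex, whose value is at most the inverse characteristic time; this yields the bound at
fixed `δ`, and then `δ → 0`. If `θs` has tied best arms, two arbitrarily close parameters with
different best arms force the expected sample size to be infinite for small `δ`
(`expectedSamples_eq_top`).

For the dual formula, fix the design and `x'`: a convex quadratic is minimized over a ball cut by an
open half-space. Separation of convex sets gives multipliers `γ` for the ball and `μ` for the
half-space (`exists_multipliers`). Completing the square (`lagrangian_eq`) and maximizing over `μ ≥
0` turns the Lagrangian bound into `dualF` (`dualF_le`, `le_iSup_dualF`). Maxima over designs exist
because an infimum of continuous functions is upper semicontinuous and the simplex is compact. -/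

namespace LinBandit

/-! ### Processes with Gaussian noise and a predictable drift -/

section Drift

variable {S : Type*} [MeasurableSpace S]

/-- The first `t` values of the process with drift `b` and noise `ω.2`. -/
noncomputable def driftPath (b : (t : ℕ) → S × (Fin t → ℝ) → ℝ) (ω : S × (ℕ → ℝ)) :
    (t : ℕ) → (Fin t → ℝ)
  | 0 => Fin.elim0
  | t + 1 => Fin.snoc (driftPath b ω t) (b t (ω.1, driftPath b ω t) + ω.2 t)

/-- The data after `t` rounds: the seed and the first `t` values of the process. -/
noncomputable def driftData (b : (t : ℕ) → S × (Fin t → ℝ) → ℝ) (t : ℕ) (ω : S × (ℕ → ℝ)) :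
    S × (Fin t → ℝ) :=
  (ω.1, driftPath b ω t)

/-- Append an observation to the data. -/
def extend {t : ℕ} (h : S × (Fin t → ℝ)) (y : ℝ) : S × (Fin (t + 1) → ℝ) :=
  (h.1, Fin.snoc h.2 y)

omit [MeasurableSpace S] in
lemma driftData_succ (b : (t : ℕ) → S × (Fin t → ℝ) → ℝ) (t : ℕ) (ω : S × (ℕ → ℝ)) :
    driftData b (t + 1) ω = extend (driftData b t ω) (b t (driftData b t ω) + ω.2 t) := rfl

lemma measurable_extend {t : ℕ} :
    Measurable (fun p : (S × (Fin t → ℝ)) × ℝ => extend p.1 p.2) := by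
  unfold extend
  refine Measurable.prodMk (by fun_prop) (measurable_pi_iff.2 fun i => ?_)
  refine Fin.lastCases ?_ (fun j => ?_) i
  · simpa using measurable_snd
  · simp only [Fin.snoc_castSucc]
    fun_prop

lemma measurable_driftData {b : (t : ℕ) → S × (Fin t → ℝ) → ℝ} (hb : ∀ t, Measurable (b t))
    (t : ℕ) : Measurable (driftData b t) := by
  induction t with
  | zero =>
    have : driftData b 0 = fun ω => (ω.1, Fin.elim0) := rfl
    rw [this]
    fun_prop
  | succ t ih =>
    have : driftData b (t + 1) = fun ω : S × (ℕ → ℝ) =>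
        (fun p : (S × (Fin t → ℝ)) × ℝ => extend p.1 p.2)
          (driftData b t ω, b t (driftData b t ω) + ω.2 t) := by
      ext1 ω; exact driftData_succ b t ω
    rw [this]
    exact measurable_extend.comp (ih.prodMk (((hb t).comp ih).add (by fun_prop)))

omit [MeasurableSpace S] in
-- The first `t` values involve only the noise coordinates below `t`. This causality is what makes
-- the noise of round `n` independent of the earlier data.
lemma driftPath_update (b : (t : ℕ) → S × (Fin t → ℝ) → ℝ) (s : S) (ξ : ℕ → ℝ) (n : ℕ) (z : ℝ)
    (t : ℕ) (ht : t ≤ n) :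
    driftPath b (s, Function.update ξ n z) t = driftPath b (s, ξ) t := by
  induction t with
  | zero => rfl
  | succ t ih =>
    simp only [driftPath]
    rw [ih (by omega), Function.update_of_ne (by omega)]

instance (ν : Measure S) [IsProbabilityMeasure ν] : IsProbabilityMeasure (noiseLaw ν) := by
  unfold noiseLaw; infer_instance

/-- Replacing one coordinate of an i.i.d. sequence by an independent copy preserves the law. -/
lemma measurePreserving_update_infinitePi (μ : Measure ℝ) [IsProbabilityMeasure μ] (n : ℕ) :
    MeasurePreserving (fun p : (ℕ → ℝ) × ℝ => Function.update p.1 n p.2)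
      ((Measure.infinitePi fun _ : ℕ => μ).prod μ) (Measure.infinitePi fun _ : ℕ => μ) := by
  classical
  have hm : Measurable (fun p : (ℕ → ℝ) × ℝ => Function.update p.1 n p.2) := by
    refine measurable_pi_iff.2 fun i => ?_
    by_cases h : i = n
    · subst h; simpa using measurable_snd
    · simp only [Function.update_of_ne h]; fun_prop
  refine ⟨hm, Measure.eq_infinitePi _ fun s t ht => ?_⟩
  rw [Measure.map_apply hm (MeasurableSet.pi s.countable_toSet fun i _ => ht i)]
  by_cases hn : n ∈ s
  · have : (fun p : (ℕ → ℝ) × ℝ => Function.update p.1 n p.2) ⁻¹' (s : Set ℕ).pi t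
        = ((s.erase n : Finset ℕ) : Set ℕ).pi t ×ˢ t n := by
      ext p
      simp only [Set.mem_preimage, Set.mem_pi, Set.mem_prod, Finset.mem_coe, Finset.mem_erase]
      constructor
      · intro h
        refine ⟨fun i hi => ?_, by simpa using h n hn⟩
        simpa [Function.update_of_ne hi.1] using h i hi.2
      · rintro ⟨h1, h2⟩ i hi
        by_cases h : i = n
        · subst h; simpa using h2
        · simpa [Function.update_of_ne h] using h1 i ⟨h, hi⟩
    rw [this, Measure.prod_prod, Measure.infinitePi_pi _ fun i _ => ht i, mul_comm,
      Finset.mul_prod_erase s (fun i => μ (t i)) hn]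
  · have : (fun p : (ℕ → ℝ) × ℝ => Function.update p.1 n p.2) ⁻¹' (s : Set ℕ).pi t
        = (s : Set ℕ).pi t ×ˢ Set.univ := by
      ext p
      simp only [Set.mem_preimage, Set.mem_pi, Set.mem_prod, Finset.mem_coe, Set.mem_univ, and_true]
      refine forall₂_congr fun i hi => ?_
      rw [Function.update_of_ne (ne_of_mem_of_not_mem hi hn)]
    rw [this, Measure.prod_prod, Measure.infinitePi_pi _ fun i _ => ht i]
    simp

lemma measurePreserving_resample (ν : Measure S) [IsProbabilityMeasure ν] (n : ℕ) :
    MeasurePreserving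
      (fun p : (S × (ℕ → ℝ)) × ℝ => ((p.1.1, Function.update p.1.2 n p.2) : S × (ℕ → ℝ)))
      ((noiseLaw ν).prod (gaussianReal 0 1)) (noiseLaw ν) :=
  ((MeasurePreserving.id ν).prod (measurePreserving_update_infinitePi _ n)).comp
    (measurePreserving_prodAssoc ν (Measure.infinitePi fun _ : ℕ => gaussianReal 0 1)
      (gaussianReal 0 1))

/-- The noise of round `n` is independent of the data gathered before. -/
lemma lintegral_driftData_noise (ν : Measure S) [IsProbabilityMeasure ν]
    {b : (t : ℕ) → S × (Fin t → ℝ) → ℝ} (hb : ∀ t, Measurable (b t)) (n : ℕ)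
    {f : (S × (Fin n → ℝ)) × ℝ → ℝ≥0∞} (hf : Measurable f) :
    ∫⁻ ω, f (driftData b n ω, ω.2 n) ∂(noiseLaw ν)
      = ∫⁻ ω, ∫⁻ z, f (driftData b n ω, z) ∂(gaussianReal 0 1) ∂(noiseLaw ν) := by
  have hH := measurable_driftData hb n
  have hm : Measurable fun ω : S × (ℕ → ℝ) => f (driftData b n ω, ω.2 n) := by fun_prop
  -- Replace coordinate `n` by a fresh copy: the earlier data do not see the replacement, so the
  -- integrand splits into independent variables and Tonelli applies.
  rw [← (measurePreserving_resample ν n).lintegral_comp hm]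
  simp only [driftData, driftPath_update _ _ _ n _ n le_rfl, Function.update_self]
  refine lintegral_prod _ (Measurable.aemeasurable ?_)
  exact hf.comp ((hH.comp measurable_fst).prodMk measurable_snd)

/-- Translation invariance of Lebesgue measure moves the shift onto the density, and the ratio of
the two Gaussian densities is the exponential factor. This is the one-round change of measure. -/
lemma lintegral_gaussianReal_const_add (m : ℝ) {f : ℝ → ℝ≥0∞} (hf : Measurable f) :
    ∫⁻ z, f (m + z) ∂(gaussianReal 0 1)
      = ∫⁻ z, f z * ENNReal.ofReal (Real.exp (m * z - m ^ 2 / 2)) ∂(gaussianReal 0 1) := by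
  have h1 : (1 : NNReal) ≠ 0 := one_ne_zero
  rw [gaussianReal_of_var_ne_zero _ h1,
    lintegral_withDensity_eq_lintegral_mul _ (measurable_gaussianPDF _ _) (by fun_prop),
    lintegral_withDensity_eq_lintegral_mul _ (measurable_gaussianPDF _ _) (by fun_prop),
    ← lintegral_add_left_eq_self _ (-m)]
  refine lintegral_congr fun z => ?_
  simp only [Pi.mul_apply, gaussianPDF, add_neg_cancel_left, gaussianPDFReal]
  rw [mul_comm (f z), ← mul_assoc, ← ENNReal.ofReal_mul (by positivity), mul_assoc _ (Real.exp _),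
    ← Real.exp_add]
  congr 4
  simp only [NNReal.coe_one]
  ring

/-- The log-likelihood ratio of the first `t` observations, for drift `b'` against drift `b`. -/
noncomputable def logLik (b b' : (t : ℕ) → S × (Fin t → ℝ) → ℝ) :
    (t : ℕ) → S × (Fin t → ℝ) → ℝ
  | 0, _ => 0
  | t + 1, h =>
    let h' : S × (Fin t → ℝ) := (h.1, Fin.init h.2)
    logLik b b' t h' + ((b' t h' - b t h') * (h.2 (Fin.last t) - b t h')
      - (b' t h' - b t h') ^ 2 / 2)

omit [MeasurableSpace S] in
-- Under drift `b` the centred observation is the noise itself, so the increment is the log density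
-- ratio for a mean shift of `b' - b`.
lemma logLik_extend (b b' : (t : ℕ) → S × (Fin t → ℝ) → ℝ) (t : ℕ) (h : S × (Fin t → ℝ))
    (z : ℝ) :
    logLik b b' (t + 1) (extend h (b t h + z))
      = logLik b b' t h + ((b' t h - b t h) * z - (b' t h - b t h) ^ 2 / 2) := by
  simp [logLik, extend]

lemma measurable_logLik {b b' : (t : ℕ) → S × (Fin t → ℝ) → ℝ} (hb : ∀ t, Measurable (b t))
    (hb' : ∀ t, Measurable (b' t)) (t : ℕ) : Measurable (logLik b b' t) := by
  induction t with
  | zero => exact measurable_const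
  | succ t ih =>
    have hi : Measurable fun h : S × (Fin (t + 1) → ℝ) =>
        ((h.1, Fin.init h.2) : S × (Fin t → ℝ)) := by
      refine measurable_fst.prodMk (measurable_pi_iff.2 fun i => ?_)
      simp only [Fin.init]
      fun_prop
    have h1 := (hb t).comp hi
    have h2 := (hb' t).comp hi
    have h3 := ih.comp hi
    simp only [Function.comp_def] at h1 h2 h3
    simp only [logLik]
    fun_prop

/-- Change of measure between two drifts. -/
lemma lintegral_driftData_change (ν : Measure S) [IsProbabilityMeasure ν]
    {b b' : (t : ℕ) → S × (Fin t → ℝ) → ℝ} (hb : ∀ t, Measurable (b t))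
    (hb' : ∀ t, Measurable (b' t)) (t : ℕ) :
    ∀ {g : S × (Fin t → ℝ) → ℝ≥0∞}, Measurable g →
    ∫⁻ ω, g (driftData b' t ω) ∂(noiseLaw ν)
      = ∫⁻ ω, g (driftData b t ω) * ENNReal.ofReal (Real.exp (logLik b b' t (driftData b t ω)))
        ∂(noiseLaw ν) := by
  induction t with
  | zero =>
    intro g hg
    simp [logLik, driftData, driftPath]
  | succ t ih =>
    intro g hg
    have hbt := hb t
    have hbt' := hb' t
    have hext := measurable_extend (S := S) (t := t)
    have hL' := measurable_logLik hb hb' (t + 1)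
    have m1 : Measurable fun p : (S × (Fin t → ℝ)) × ℝ => g (extend p.1 (b' t p.1 + p.2)) :=
      hg.comp (hext.comp (measurable_fst.prodMk ((hbt'.comp measurable_fst).add measurable_snd)))
    have m2 : Measurable fun p : (S × (Fin t → ℝ)) × ℝ => extend p.1 (b t p.1 + p.2) :=
      hext.comp (measurable_fst.prodMk ((hbt.comp measurable_fst).add measurable_snd))
    have e1 : ∀ ω, g (driftData b' (t + 1) ω)
        = (fun p : (S × (Fin t → ℝ)) × ℝ => g (extend p.1 (b' t p.1 + p.2)))
          (driftData b' t ω, ω.2 t) := fun ω => by rw [driftData_succ]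
    simp_rw [e1]
    rw [lintegral_driftData_noise ν hb' t m1]
    have m3 : Measurable fun h : S × (Fin t → ℝ) =>
        ∫⁻ z, g (extend h (b' t h + z)) ∂(gaussianReal 0 1) := m1.lintegral_prod_right'
    -- Once the last noise is integrated out, the integrand depends on the first `t` rounds only.
    -- The induction hypothesis changes the law of those, and the Gaussian shift below accounts for
    -- the last round.
    rw [ih m3]
    have m4 : Measurable fun p : (S × (Fin t → ℝ)) × ℝ => g (extend p.1 (b t p.1 + p.2))
        * ENNReal.ofReal (Real.exp (logLik b b' (t + 1) (extend p.1 (b t p.1 + p.2)))) :=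
      (hg.comp m2).mul (hL'.comp m2).exp.ennreal_ofReal
    have e2 : ∀ ω, g (driftData b (t + 1) ω)
          * ENNReal.ofReal (Real.exp (logLik b b' (t + 1) (driftData b (t + 1) ω)))
        = (fun p : (S × (Fin t → ℝ)) × ℝ => g (extend p.1 (b t p.1 + p.2))
          * ENNReal.ofReal (Real.exp (logLik b b' (t + 1) (extend p.1 (b t p.1 + p.2)))))
          (driftData b t ω, ω.2 t) := fun ω => by rw [driftData_succ]
    simp_rw [e2]
    rw [lintegral_driftData_noise ν hb t m4]
    refine lintegral_congr fun ω => ?_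
    set h := driftData b t ω
    have m5 : Measurable fun z : ℝ => g (extend h (b t h + z)) :=
      (hg.comp m2).comp (measurable_const.prodMk measurable_id)
    have e3 : ∀ z : ℝ, g (extend h (b' t h + z))
        = (fun z => g (extend h (b t h + z))) ((b' t h - b t h) + z) := fun z => by
      simp only; congr 2; ring
    simp_rw [e3]
    have m6 : Measurable fun z : ℝ => g (extend h (b t h + z))
        * ENNReal.ofReal (Real.exp ((b' t h - b t h) * z - (b' t h - b t h) ^ 2 / 2)) :=
      m5.mul (Measurable.ennreal_ofReal (by fun_prop))
    rw [lintegral_gaussianReal_const_add _ m5, ← lintegral_mul_const _ m6]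
    refine lintegral_congr fun z => ?_
    rw [logLik_extend, Real.exp_add, ENNReal.ofReal_mul (Real.exp_nonneg _), mul_assoc]
    congr 1
    exact mul_comm _ _

/-- The noise of round `n` is centered, even when multiplied by a function of the past. -/
lemma integral_driftData_mul_noise (ν : Measure S) [IsProbabilityMeasure ν]
    {b : (t : ℕ) → S × (Fin t → ℝ) → ℝ} (hb : ∀ t, Measurable (b t)) (n : ℕ)
    {f : S × (Fin n → ℝ) → ℝ} (hf : Measurable f) :
    ∫ ω, f (driftData b n ω) * ω.2 n ∂(noiseLaw ν) = 0 := by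
  have hH := measurable_driftData hb n
  have hm : Measurable fun ω : S × (ℕ → ℝ) => f (driftData b n ω) * ω.2 n := by fun_prop
  have hmp := measurePreserving_resample ν n
  rw [← hmp.map_eq, integral_map hmp.aemeasurable hm.aestronglyMeasurable]
  simp only [driftData, driftPath_update _ _ _ n _ n le_rfl, Function.update_self]
  have := integral_prod_mul (μ := noiseLaw ν) (ν := gaussianReal 0 1)
    (fun ω => f (driftData b n ω)) (fun z => z)
  simp only [driftData] at this
  rw [this]
  simp [integral_id_gaussianReal]

lemma integrable_noise (ν : Measure S) [IsProbabilityMeasure ν] (n : ℕ) :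
    Integrable (fun ω : S × (ℕ → ℝ) => ω.2 n) (noiseLaw ν) := by
  have hmp := measurePreserving_resample ν n
  have hm : Measurable fun ω : S × (ℕ → ℝ) => ω.2 n := by fun_prop
  rw [← hmp.integrable_comp hm.aestronglyMeasurable]
  simp only [Function.comp_def, Function.update_self]
  have h : Integrable (fun z : ℝ => z) (gaussianReal 0 1) :=
    (memLp_id_gaussianReal (μ := 0) (v := 1) 1).integrable (by simp)
  exact h.comp_snd (noiseLaw ν)

/-- The mean is minus the Kullback-Leibler divergence of the two processes. The terms linear in the
noise vanish in mean because their coefficients depend on the past; the bound `K` makes every term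
integrable. -/
lemma integrable_logLik (ν : Measure S) [IsProbabilityMeasure ν]
    {b b' : (t : ℕ) → S × (Fin t → ℝ) → ℝ} (hb : ∀ t, Measurable (b t))
    (hb' : ∀ t, Measurable (b' t)) {K : ℝ} (hK : ∀ t h, |b' t h - b t h| ≤ K) (n : ℕ) :
    Integrable (fun ω => logLik b b' n (driftData b n ω)) (noiseLaw ν) ∧
    ∫ ω, logLik b b' n (driftData b n ω) ∂(noiseLaw ν)
      = -∑ i ∈ Finset.range n,
        (∫ ω, (b' i (driftData b i ω) - b i (driftData b i ω)) ^ 2 ∂(noiseLaw ν)) / 2 := by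
  induction n with
  | zero => simp [logLik]
  | succ n ih =>
    have hH := measurable_driftData hb n
    have hbn := hb n
    have hbn' := hb' n
    have i1 : Integrable (fun ω : S × (ℕ → ℝ) =>
        (b' n (driftData b n ω) - b n (driftData b n ω)) * ω.2 n) (noiseLaw ν) :=
      (integrable_noise ν n).bdd_mul (by fun_prop) (ae_of_all _ fun ω => hK n _)
    have i2 : Integrable (fun ω : S × (ℕ → ℝ) =>
        (b' n (driftData b n ω) - b n (driftData b n ω)) ^ 2 / 2) (noiseLaw ν) := by
      refine Integrable.of_bound (by fun_prop) (K ^ 2 / 2) (ae_of_all _ fun ω => ?_)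
      have h1 := hK n (driftData b n ω)
      rw [Real.norm_eq_abs, abs_of_nonneg (by positivity)]
      have := sq_le_sq' (neg_le_of_abs_le h1) (le_of_abs_le h1)
      linarith
    have e : ∀ ω, logLik b b' (n + 1) (driftData b (n + 1) ω) = logLik b b' n (driftData b n ω)
        + ((b' n (driftData b n ω) - b n (driftData b n ω)) * ω.2 n
          - (b' n (driftData b n ω) - b n (driftData b n ω)) ^ 2 / 2) := fun ω => by
      rw [driftData_succ, logLik_extend]
    simp_rw [e]
    refine ⟨ih.1.add (i1.sub i2), ?_⟩
    have hz := integral_driftData_mul_noise ν hb n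
      (f := fun h => b' n h - b n h) (by fun_prop)
    rw [integral_add ih.1 (by exact i1.sub i2), integral_sub i1 i2, ih.2, hz,
      Finset.sum_range_succ, integral_div]
    ring

/-- Transportation inequality: an event that is `δ`-rare under the drift `b'` can be likely under
the drift `b` only if the accumulated information is of order `log (1 / δ)`. -/
lemma log_mul_measureReal_le (ν : Measure S) [IsProbabilityMeasure ν]
    {b b' : (t : ℕ) → S × (Fin t → ℝ) → ℝ} (hb : ∀ t, Measurable (b t))
    (hb' : ∀ t, Measurable (b' t)) {K : ℝ} (hK : ∀ t h, |b' t h - b t h| ≤ K) (n : ℕ)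
    {G : Set (S × (Fin n → ℝ))} (hG : MeasurableSet G) {δ : ℝ} (hδ : 0 < δ)
    (hG' : noiseLaw ν (driftData b' n ⁻¹' G) ≤ ENNReal.ofReal δ) :
    Real.log (1 / δ) * (noiseLaw ν).real (driftData b n ⁻¹' G) ≤ Real.log 2
      + ∑ i ∈ Finset.range n,
        (∫ ω, (b' i (driftData b i ω) - b i (driftData b i ω)) ^ 2 ∂(noiseLaw ν)) / 2 := by
  obtain ⟨hi, he⟩ := integrable_logLik ν hb hb' hK n
  have hH := measurable_driftData hb n
  have hH' := measurable_driftData hb' n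
  have hL := measurable_logLik hb hb' n
  set c := Real.log (1 / δ) with hc
  have hec : Real.exp c = 1 / δ := Real.exp_log (by positivity)
  -- Test function of the variational inequality: `exp φ` is `1 / δ` on `G` and `1` elsewhere, so
  -- its mean under `b'` is at most `1 + (1 / δ) * δ = 2`.
  let φ : S × (Fin n → ℝ) → ℝ := G.indicator fun _ => c
  have hφ : Measurable φ := measurable_const.indicator hG
  have hφi : Integrable (fun ω => φ (driftData b n ω)) (noiseLaw ν) := by
    refine Integrable.of_bound (hφ.comp hH).aestronglyMeasurable |c| (ae_of_all _ fun ω => ?_)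
    by_cases h : driftData b n ω ∈ G <;> simp [φ, h]
  have hφe : ∫ ω, φ (driftData b n ω) ∂(noiseLaw ν)
      = c * (noiseLaw ν).real (driftData b n ⁻¹' G) := by
    have : (fun ω => φ (driftData b n ω)) = (driftData b n ⁻¹' G).indicator fun _ => c := by
      ext ω; by_cases h : driftData b n ω ∈ G <;> simp [φ, h]
    rw [this, integral_indicator_const _ (hH hG), smul_eq_mul, mul_comm]
  have hle : ∫⁻ ω, ENNReal.ofReal
      (Real.exp (φ (driftData b n ω) + logLik b b' n (driftData b n ω))) ∂(noiseLaw ν) ≤ 2 := by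
    have h1 := lintegral_driftData_change ν hb hb' n
      (g := fun h => ENNReal.ofReal (Real.exp (φ h))) (by fun_prop)
    simp_rw [Real.exp_add, ENNReal.ofReal_mul (Real.exp_nonneg _)]
    rw [← h1]
    calc ∫⁻ ω, ENNReal.ofReal (Real.exp (φ (driftData b' n ω))) ∂(noiseLaw ν)
        ≤ ∫⁻ ω, (1 + (driftData b' n ⁻¹' G).indicator (fun _ => ENNReal.ofReal (1 / δ)) ω)
            ∂(noiseLaw ν) := by
          refine lintegral_mono fun ω => ?_
          by_cases h : driftData b' n ω ∈ G <;> simp [φ, h, hec]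
      _ = 1 + ENNReal.ofReal (1 / δ) * noiseLaw ν (driftData b' n ⁻¹' G) := by
          rw [lintegral_add_left measurable_const, lintegral_indicator_const (hH' hG)]
          simp
      _ ≤ 1 + ENNReal.ofReal (1 / δ) * ENNReal.ofReal δ := by gcongr
      _ = 2 := by
          rw [← ENNReal.ofReal_mul (by positivity), one_div_mul_cancel hδ.ne', ENNReal.ofReal_one,
            one_add_one_eq_two]
  have hint : Integrable (fun ω => Real.exp
      (φ (driftData b n ω) + logLik b b' n (driftData b n ω))) (noiseLaw ν) := by
    refine (lintegral_ofReal_ne_top_iff_integrable (by fun_prop)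
      (ae_of_all _ fun ω => Real.exp_nonneg _)).1 (ne_top_of_le_ne_top (by simp) hle)
  have hint2 : ∫ ω, Real.exp (φ (driftData b n ω) + logLik b b' n (driftData b n ω))
      ∂(noiseLaw ν) ≤ 2 := by
    rw [integral_eq_lintegral_of_nonneg_ae (ae_of_all _ fun ω => Real.exp_nonneg _) (by fun_prop)]
    exact ENNReal.toReal_le_of_le_ofReal (by simp) (by simpa using hle)
  -- The tangent line of the logarithm at `2` replaces Jensen's inequality: as the exponential has
  -- mean at most `2`, integration leaves exactly `log 2`.
  have hpt : ∀ x : ℝ, x ≤ Real.exp x / 2 - 1 + Real.log 2 := fun x => by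
    have h1 := Real.add_one_le_exp (x - Real.log 2)
    rw [Real.exp_sub, Real.exp_log (by norm_num)] at h1
    linarith
  have hmono := integral_mono (hφi.add hi)
    ((hint.div_const 2).add (integrable_const (Real.log 2 - 1)))
    (fun ω => by
      have := hpt (φ (driftData b n ω) + logLik b b' n (driftData b n ω))
      simp only [Pi.add_apply]; linarith)
  rw [integral_add' hφi hi, integral_add' (hint.div_const 2) (integrable_const _), hφe, he,
    integral_div, integral_const] at hmono
  simp only [probReal_univ, smul_eq_mul] at hmono
  linarith

end Drift

/-! ### The information gathered up to the stopping time -/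

section Transport

variable {d : ℕ} {X : Finset (EuclideanSpace ℝ (Fin d))} {S : Type*}

/-- The data available after the first `k` of `t` rounds. -/
def restrictData {k t : ℕ} (hk : k ≤ t) (h : S × (Fin t → ℝ)) : S × (Fin k → ℝ) :=
  (h.1, fun i => h.2 (Fin.castLE hk i))

lemma restrictData_driftData (b : (t : ℕ) → S × (Fin t → ℝ) → ℝ) (ω : S × (ℕ → ℝ)) {k t : ℕ}
    (hk : k ≤ t) : restrictData hk (driftData b t ω) = driftData b k ω := by
  induction t, hk using Nat.le_induction with
  | base => rfl
  | succ t hk ih =>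
    rw [← ih]
    simp only [restrictData, driftData, driftPath, Prod.mk.injEq, true_and]
    ext i
    exact Fin.snoc_castSucc (α := fun _ => ℝ) _ _ (Fin.castLE hk i)

variable [MeasurableSpace S]

lemma measurable_restrictData {k t : ℕ} (hk : k ≤ t) :
    Measurable (restrictData (S := S) hk) := by
  unfold restrictData; fun_prop

namespace Strategy

variable (a : Strategy X S)

/-- The mean reward of the next arm, as a function of the data. -/
noncomputable def meanDrift (θ : EuclideanSpace ℝ (Fin d)) (t : ℕ) (h : S × (Fin t → ℝ)) : ℝ :=
  inner ℝ θ (a.arm t h : EuclideanSpace ℝ (Fin d))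

lemma rewards_eq_driftPath (θ : EuclideanSpace ℝ (Fin d)) (ω : S × (ℕ → ℝ)) (t : ℕ) :
    a.rewards θ ω t = driftPath (a.meanDrift θ) ω t := by
  induction t with
  | zero => rfl
  | succ t ih => simp only [rewards, driftPath, ih, meanDrift]

lemma rewards_data (θ : EuclideanSpace ℝ (Fin d)) (ω : S × (ℕ → ℝ)) (t : ℕ) :
    (ω.1, a.rewards θ ω t) = driftData (a.meanDrift θ) t ω := by
  rw [rewards_eq_driftPath, driftData]

lemma stopTime_le_iff (θ : EuclideanSpace ℝ (Fin d)) (ω : S × (ℕ → ℝ)) (n : ℕ) :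
    a.stopTime θ ω ≤ n ↔ ∃ k ≤ n, driftData (a.meanDrift θ) k ω ∈ a.haltSet k := by
  constructor
  · intro h
    by_contra! hc
    have : ((n + 1 : ℕ) : ℕ∞) ≤ a.stopTime θ ω := by
      refine le_iInf₂ fun k hk => ?_
      rw [rewards_data] at hk
      have : n < k := by
        by_contra! hkn
        exact hc k hkn hk
      exact_mod_cast this
    have := this.trans h
    norm_cast at this
    omega
  · rintro ⟨k, hk, hm⟩
    rw [← rewards_data] at hm
    exact (iInf₂_le k hm).trans (by exact_mod_cast hk)

lemma stopTime_eq_iff (θ : EuclideanSpace ℝ (Fin d)) (ω : S × (ℕ → ℝ)) (k : ℕ) :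
    a.stopTime θ ω = k ↔ driftData (a.meanDrift θ) k ω ∈ a.haltSet k ∧
      ∀ j < k, driftData (a.meanDrift θ) j ω ∉ a.haltSet j := by
  constructor
  · intro h
    have h1 : ∀ j < k, driftData (a.meanDrift θ) j ω ∉ a.haltSet j := fun j hj hm => by
      have := (a.stopTime_le_iff θ ω j).2 ⟨j, le_rfl, hm⟩
      rw [h] at this
      norm_cast at this
      omega
    obtain ⟨j, hj, hm⟩ := (a.stopTime_le_iff θ ω k).1 h.le
    obtain rfl | hlt := hj.eq_or_lt
    · exact ⟨hm, h1⟩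
    · exact absurd hm (h1 j hlt)
  · rintro ⟨h1, h2⟩
    refine le_antisymm ((a.stopTime_le_iff θ ω k).2 ⟨k, le_rfl, h1⟩) ?_
    refine le_iInf₂ fun j hj => ?_
    rw [rewards_data] at hj
    have : k ≤ j := by
      by_contra! hlt
      exact h2 j hlt hj
    exact_mod_cast this

/-- The data on which the stopping rule has already been met. -/
def haltedSet (t : ℕ) : Set (S × (Fin t → ℝ)) :=
  {h | ∃ (k : ℕ) (hk : k ≤ t), restrictData hk h ∈ a.haltSet k}

lemma measurableSet_haltedSet (t : ℕ) : MeasurableSet (a.haltedSet t) := by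
  have : a.haltedSet t = ⋃ (k : ℕ) (hk : k ≤ t), restrictData hk ⁻¹' a.haltSet k := by
    ext h; simp [haltedSet]
  rw [this]
  exact MeasurableSet.iUnion fun k => MeasurableSet.iUnion fun hk =>
    measurable_restrictData hk (a.measurableSet_haltSet k)

lemma driftData_mem_haltedSet_iff (θ : EuclideanSpace ℝ (Fin d)) (ω : S × (ℕ → ℝ)) (t : ℕ) :
    driftData (a.meanDrift θ) t ω ∈ a.haltedSet t ↔ a.stopTime θ ω ≤ t := by
  rw [stopTime_le_iff]
  simp only [haltedSet, Set.mem_ofPred_eq, restrictData_driftData, exists_prop]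

/-- The data on which the learner has stopped with an arm different from `z`. -/
def wrongSet (z : EuclideanSpace ℝ (Fin d)) (t : ℕ) : Set (S × (Fin t → ℝ)) :=
  {h | ∃ (k : ℕ) (hk : k ≤ t), restrictData hk h ∈ a.haltSet k ∧
    (∀ (j : ℕ) (hj : j < k), restrictData (hj.le.trans hk) h ∉ a.haltSet j) ∧
    (a.answer k (restrictData hk h) : EuclideanSpace ℝ (Fin d)) ≠ z}

lemma measurableSet_wrongSet (z : EuclideanSpace ℝ (Fin d)) (t : ℕ) :
    MeasurableSet (a.wrongSet z t) := by
  have : a.wrongSet z t = ⋃ (k : ℕ) (hk : k ≤ t), (restrictData hk ⁻¹' a.haltSet k ∩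
      (⋂ (j : ℕ) (hj : j < k), (restrictData (hj.le.trans hk) ⁻¹' a.haltSet j)ᶜ) ∩
      (restrictData hk ⁻¹' (a.answer k ⁻¹' {x | (x : EuclideanSpace ℝ (Fin d)) ≠ z}))) := by
    ext h; simp [wrongSet, and_assoc]
  rw [this]
  refine MeasurableSet.iUnion fun k => MeasurableSet.iUnion fun hk =>
    ((measurable_restrictData hk (a.measurableSet_haltSet k)).inter
      (MeasurableSet.iInter fun j => MeasurableSet.iInter fun hj =>
        (measurable_restrictData _ (a.measurableSet_haltSet j)).compl)).inter
      (measurable_restrictData hk (a.measurable_answer k (Set.toFinite _).measurableSet))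

lemma driftData_mem_wrongSet_iff (θ z : EuclideanSpace ℝ (Fin d)) (ω : S × (ℕ → ℝ)) (t : ℕ) :
    driftData (a.meanDrift θ) t ω ∈ a.wrongSet z t ↔ ∃ k ≤ t, a.stopTime θ ω = k ∧
      (a.answer k (ω.1, a.rewards θ ω k) : EuclideanSpace ℝ (Fin d)) ≠ z := by
  simp only [wrongSet, Set.mem_ofPred_eq, restrictData_driftData, exists_prop, stopTime_eq_iff,
    rewards_data, and_assoc]

open Classical in
/-- The drift that equals the mean reward under `θ` up to the stopping time, and the mean reward
under `θs` from then on. -/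
noncomputable def switchDrift (θs θ : EuclideanSpace ℝ (Fin d)) (t : ℕ) (h : S × (Fin t → ℝ)) :
    ℝ :=
  if h ∈ a.haltedSet t then a.meanDrift θs t h else a.meanDrift θ t h

lemma measurable_meanDrift (θ : EuclideanSpace ℝ (Fin d)) (t : ℕ) :
    Measurable (a.meanDrift θ t) := by
  have := a.measurable_arm t
  have h2 : Measurable fun h => (a.arm t h : EuclideanSpace ℝ (Fin d)) :=
    measurable_subtype_coe.comp this
  unfold meanDrift
  fun_prop

lemma measurable_switchDrift (θs θ : EuclideanSpace ℝ (Fin d)) (t : ℕ) :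
    Measurable (a.switchDrift θs θ t) :=
  Measurable.ite (a.measurableSet_haltedSet t) (a.measurable_meanDrift θs t)
    (a.measurable_meanDrift θ t)

/-- With the same noise, the two processes differ only after the stopping rule has been met. -/
lemma driftData_switchDrift (θs θ : EuclideanSpace ℝ (Fin d)) (ω : S × (ℕ → ℝ)) (k : ℕ)
    (hk : ∀ j < k, driftData (a.switchDrift θs θ) j ω ∉ a.haltSet j) :
    driftData (a.switchDrift θs θ) k ω = driftData (a.meanDrift θ) k ω := by
  induction k with
  | zero => rfl
  | succ k ih =>
    have hn : driftData (a.switchDrift θs θ) k ω ∉ a.haltedSet k := by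
      rintro ⟨j, hj, hm⟩
      rw [restrictData_driftData] at hm
      exact hk j (by omega) hm
    rw [driftData_succ, driftData_succ, switchDrift, if_neg hn,
      ih fun j hj => hk j (by omega)]

/-- The stopping time and the answer are determined by data gathered before the switch. Hence the
error bound under `θ` also holds for the switched process. -/
lemma wrongSet_of_switchDrift (θs θ z : EuclideanSpace ℝ (Fin d)) (ω : S × (ℕ → ℝ)) (t : ℕ)
    (h : driftData (a.switchDrift θs θ) t ω ∈ a.wrongSet z t) :
    ∃ k : ℕ, a.stopTime θ ω = k ∧
      (a.answer k (ω.1, a.rewards θ ω k) : EuclideanSpace ℝ (Fin d)) ≠ z := by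
  obtain ⟨k, hk, h1, h2, h3⟩ := h
  simp only [restrictData_driftData] at h1 h2 h3
  have he : ∀ j ≤ k, driftData (a.switchDrift θs θ) j ω = driftData (a.meanDrift θ) j ω :=
    fun j hj => a.driftData_switchDrift θs θ ω j fun i hi => h2 i (by omega)
  rw [he k le_rfl] at h1 h3
  refine ⟨k, (a.stopTime_eq_iff θ ω k).2 ⟨h1, fun j hj => ?_⟩, ?_⟩
  · rw [← he j hj.le]; exact h2 j hj
  · rw [rewards_data]; exact h3

/-- The probability that the learner pulls the arm `x` in round `i`. -/
noncomputable def pullProb (ν : Measure S) (θ : EuclideanSpace ℝ (Fin d)) (i : ℕ) (x : X) : ℝ≥0∞ :=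
  noiseLaw ν (driftData (a.meanDrift θ) i ⁻¹' ((a.haltedSet i)ᶜ ∩ a.arm i ⁻¹' {x}))

/-- The expected number of pulls of the arm `x`. -/
noncomputable def expectedPulls (ν : Measure S) (θ : EuclideanSpace ℝ (Fin d)) (x : X) : ℝ≥0∞ :=
  ∑' i, a.pullProb ν θ i x

/-- Tail-sum form of the stopping time: round `i`, counted from `0`, is played exactly when `i < τ`.
-/
lemma _root_.ENat.toENNReal_eq_tsum (τ : ℕ∞) :
    (τ : ℝ≥0∞) = ∑' i : ℕ, if (i : ℕ∞) < τ then (1 : ℝ≥0∞) else 0 := by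
  induction τ using ENat.recTopCoe with
  | top => simp
  | coe n =>
    rw [tsum_eq_sum (s := Finset.range n)]
    · rw [Finset.sum_congr rfl fun i hi => if_pos (by simpa using hi)]
      simp
    · intro i hi
      rw [if_neg (by simpa using hi)]

lemma sum_expectedPulls (ν : Measure S) [IsProbabilityMeasure ν]
    (θ : EuclideanSpace ℝ (Fin d)) :
    ∑ x, a.expectedPulls ν θ x = a.expectedSamples ν θ := by
  have hms : ∀ i, MeasurableSet (driftData (a.meanDrift θ) i ⁻¹' (a.haltedSet i)ᶜ) := fun i =>
    measurable_driftData (a.measurable_meanDrift θ) i (a.measurableSet_haltedSet i).compl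
  have h1 : ∀ i, ∑ x, a.pullProb ν θ i x
      = noiseLaw ν (driftData (a.meanDrift θ) i ⁻¹' (a.haltedSet i)ᶜ) := fun i => by
    have hu : driftData (a.meanDrift θ) i ⁻¹' (a.haltedSet i)ᶜ = ⋃ x ∈ (Finset.univ : Finset X),
        driftData (a.meanDrift θ) i ⁻¹' ((a.haltedSet i)ᶜ ∩ a.arm i ⁻¹' {x}) := by
      ext ω; simp
    rw [hu, measure_biUnion_finset]
    · rfl
    · intro x _ y _ hxy
      refine Set.disjoint_left.2 fun ω h h' => hxy ?_
      simp only [Set.mem_preimage, Set.mem_inter_iff, Set.mem_singleton_iff] at h h'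
      exact h.2.symm.trans h'.2
    · intro x _
      exact measurable_driftData (a.measurable_meanDrift θ) i
        ((a.measurableSet_haltedSet i).compl.inter (a.measurable_arm i (measurableSet_singleton x)))
  unfold expectedPulls expectedSamples
  rw [← Summable.tsum_finsetSum fun _ _ => ENNReal.summable]
  simp_rw [h1, ENat.toENNReal_eq_tsum]
  have h2 : ∀ ω (i : ℕ), (if (i : ℕ∞) < a.stopTime θ ω then (1 : ℝ≥0∞) else 0)
      = (driftData (a.meanDrift θ) i ⁻¹' (a.haltedSet i)ᶜ).indicator (fun _ => 1) ω := by
    intro ω i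
    have := a.driftData_mem_haltedSet_iff θ ω i
    by_cases h : a.stopTime θ ω ≤ i
    · simp [not_lt.2 h, this.2 h]
    · simp [not_le.1 h, this.not.2 h]
  simp_rw [h2]
  rw [lintegral_tsum fun i => (measurable_const.indicator (hms i)).aemeasurable]
  refine tsum_congr fun i => ?_
  rw [lintegral_indicator_const (hms i), one_mul]

/-- After stopping the two drifts agree, and before stopping they differ by `⟪θ - θs, x⟫` for the
arm `x` pulled; hence only pulls before stopping contribute to the divergence. -/
lemma integral_sq_switchDrift_sub (ν : Measure S) [IsProbabilityMeasure ν]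
    (θs θ : EuclideanSpace ℝ (Fin d)) (i : ℕ) :
    ∫ ω, (a.switchDrift θs θ i (driftData (a.meanDrift θs) i ω)
        - a.meanDrift θs i (driftData (a.meanDrift θs) i ω)) ^ 2 ∂(noiseLaw ν)
      = ∑ x : X, (a.pullProb ν θs i x).toReal
          * (inner ℝ (θ - θs) (x : EuclideanSpace ℝ (Fin d))) ^ 2 := by
  have hms : ∀ x, MeasurableSet
      (driftData (a.meanDrift θs) i ⁻¹' ((a.haltedSet i)ᶜ ∩ a.arm i ⁻¹' {x})) := fun x =>
    measurable_driftData (a.measurable_meanDrift θs) i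
      ((a.measurableSet_haltedSet i).compl.inter (a.measurable_arm i (measurableSet_singleton x)))
  have h : ∀ ω, (a.switchDrift θs θ i (driftData (a.meanDrift θs) i ω)
        - a.meanDrift θs i (driftData (a.meanDrift θs) i ω)) ^ 2
      = ∑ x : X, (driftData (a.meanDrift θs) i ⁻¹' ((a.haltedSet i)ᶜ ∩ a.arm i ⁻¹' {x})).indicator
          (fun _ => (inner ℝ (θ - θs) (x : EuclideanSpace ℝ (Fin d))) ^ 2) ω := by
    intro ω
    set H := driftData (a.meanDrift θs) i ω with hH
    by_cases hh : H ∈ a.haltedSet i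
    · simp [switchDrift, hh, ← hH]
    · rw [Finset.sum_eq_single (a.arm i H)]
      · rw [Set.indicator_of_mem (by simp [← hH, hh]), switchDrift, if_neg hh, meanDrift,
          meanDrift, inner_sub_left]
      · intro x _ hx
        rw [Set.indicator_of_notMem]
        simp [← hH, hx.symm]
      · simp
  simp_rw [h]
  rw [integral_finsetSum _ fun x _ => (integrable_const _).indicator (hms x)]
  refine Finset.sum_congr rfl fun x _ => ?_
  rw [integral_indicator_const _ (hms x), smul_eq_mul, Measure.real, pullProb]

/-- The probability of stopping with an arm other than `z` is controlled by the information
gathered against a parameter under which `z` is the unique best arm. -/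
lemma log_mul_stop_le (ν : Measure S) [IsProbabilityMeasure ν] {R δ : ℝ} (hδ : 0 < δ)
    (ha : a.IsDeltaCorrect ν R δ) {θs : EuclideanSpace ℝ (Fin d)}
    (hfin : a.expectedSamples ν θs ≠ ∞) {θ z : EuclideanSpace ℝ (Fin d)} (hθ : ‖θ‖ ≤ R)
    (hz : IsUniqueBest X θ z) :
    Real.log (1 / δ) * (noiseLaw ν).real {ω | ∃ k : ℕ, a.stopTime θs ω = k ∧
        (a.answer k (ω.1, a.rewards θs ω k) : EuclideanSpace ℝ (Fin d)) ≠ z}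
      ≤ Real.log 2 + 1 / 2 * ∑ x : X, (a.expectedPulls ν θs x).toReal
          * (inner ℝ (θ - θs) (x : EuclideanSpace ℝ (Fin d))) ^ 2 := by
  have hN : ∀ x, a.expectedPulls ν θs x ≠ ∞ := by
    rw [← sum_expectedPulls] at hfin
    simpa using ENNReal.sum_ne_top.1 hfin
  have hK : ∀ t h, |a.switchDrift θs θ t h - a.meanDrift θs t h|
      ≤ ∑ x : X, |inner ℝ (θ - θs) (x : EuclideanSpace ℝ (Fin d))| := by
    intro t h
    by_cases hh : h ∈ a.haltedSet t
    · simp only [switchDrift, if_pos hh, sub_self, abs_zero]; positivity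
    · simp only [switchDrift, if_neg hh, meanDrift, ← inner_sub_left]
      exact Finset.single_le_sum
        (f := fun x : X => |inner ℝ (θ - θs) (x : EuclideanSpace ℝ (Fin d))|)
        (fun _ _ => abs_nonneg _) (Finset.mem_univ (a.arm t h))
  -- The transportation inequality works at a finite horizon. The right-hand side does not depend on
  -- `n`, so continuity from below along the increasing events removes the horizon.
  have hbound : ∀ n : ℕ, Real.log (1 / δ) * (noiseLaw ν).real
      (driftData (a.meanDrift θs) n ⁻¹' a.wrongSet z n)
      ≤ Real.log 2 + 1 / 2 * ∑ x : X, (a.expectedPulls ν θs x).toReal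
          * (inner ℝ (θ - θs) (x : EuclideanSpace ℝ (Fin d))) ^ 2 := by
    intro n
    have h1 := log_mul_measureReal_le ν (a.measurable_meanDrift θs)
      (a.measurable_switchDrift θs θ) hK n (a.measurableSet_wrongSet z n) hδ
      ((measure_mono fun ω hω => a.wrongSet_of_switchDrift θs θ z ω n hω).trans (ha θ hθ z hz))
    refine h1.trans ?_
    simp_rw [integral_sq_switchDrift_sub]
    rw [← Finset.sum_div, Finset.sum_comm, div_eq_inv_mul, one_div]
    simp_rw [← Finset.sum_mul]
    gcongr with x
    rw [← ENNReal.toReal_sum fun i _ => by unfold pullProb; exact measure_ne_top _ _]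
    exact ENNReal.toReal_mono (hN x) (ENNReal.sum_le_tsum _)
  have hset : {ω | ∃ k : ℕ, a.stopTime θs ω = k ∧
        (a.answer k (ω.1, a.rewards θs ω k) : EuclideanSpace ℝ (Fin d)) ≠ z}
      = ⋃ n, driftData (a.meanDrift θs) n ⁻¹' a.wrongSet z n := by
    ext ω
    simp only [Set.mem_iUnion, Set.mem_preimage, driftData_mem_wrongSet_iff, Set.mem_ofPred_eq]
    exact ⟨fun ⟨k, h⟩ => ⟨k, k, le_rfl, h⟩, fun ⟨n, k, _, h⟩ => ⟨k, h⟩⟩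
  have hmono : Monotone fun n => driftData (a.meanDrift θs) n ⁻¹' a.wrongSet z n := by
    intro n m hnm ω
    simp only [Set.mem_preimage, driftData_mem_wrongSet_iff]
    exact fun ⟨k, hk, h⟩ => ⟨k, hk.trans hnm, h⟩
  have hlim : Tendsto (fun n => (noiseLaw ν).real (driftData (a.meanDrift θs) n ⁻¹' a.wrongSet z n))
      atTop (𝓝 ((noiseLaw ν).real (⋃ n, driftData (a.meanDrift θs) n ⁻¹' a.wrongSet z n))) :=
    (ENNReal.tendsto_toReal (measure_ne_top _ _)).comp (tendsto_measure_iUnion_atTop hmono)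
  rw [hset]
  exact le_of_tendsto (hlim.const_mul _) (Eventually.of_forall hbound)

end Strategy

end Transport

/-! ### Quadratic forms and Lagrangian duality -/

section Duality

variable {d : ℕ}

lemma inner_eq_dotProduct (u v : EuclideanSpace ℝ (Fin d)) :
    (inner ℝ u v : ℝ) = u.ofLp ⬝ᵥ v.ofLp := by
  rw [EuclideanSpace.inner_eq_star_dotProduct, dotProduct_comm]
  simp

lemma quad_designMatrix (X : Finset (EuclideanSpace ℝ (Fin d))) (w : X → ℝ)
    (u : EuclideanSpace ℝ (Fin d)) :
    quad (designMatrix X w) u u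
      = ∑ x : X, w x * (inner ℝ u (x : EuclideanSpace ℝ (Fin d))) ^ 2 := by
  simp only [quad, designMatrix, Matrix.sum_mulVec, dotProduct_sum, Matrix.smul_mulVec,
    Matrix.vecMulVec_mulVec, dotProduct_smul, inner_eq_dotProduct]
  refine Finset.sum_congr rfl fun x _ => ?_
  simp only [op_smul_eq_smul, smul_eq_mul]
  rw [dotProduct_comm (x : EuclideanSpace ℝ (Fin d)).ofLp]
  ring

lemma posSemidef_designMatrix (X : Finset (EuclideanSpace ℝ (Fin d))) {w : X → ℝ}
    (hw : ∀ x, 0 ≤ w x) : (designMatrix X w).PosSemidef := by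
  unfold designMatrix
  refine Matrix.posSemidef_sum _ fun x _ => Matrix.PosSemidef.smul ?_ (hw x)
  simpa using Matrix.posSemidef_vecMulVec_self_star (x : EuclideanSpace ℝ (Fin d)).ofLp

lemma quad_comm {M : Matrix (Fin d) (Fin d) ℝ} (hM : M.IsHermitian)
    (u v : EuclideanSpace ℝ (Fin d)) : quad M u v = quad M v u := by
  have ht : Mᵀ = M := by simpa [Matrix.IsSymm] using hM
  unfold quad
  rw [Matrix.dotProduct_mulVec, ← Matrix.mulVec_transpose, ht, dotProduct_comm]

lemma quad_sub_self {M : Matrix (Fin d) (Fin d) ℝ} (hM : M.IsHermitian)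
    (u v : EuclideanSpace ℝ (Fin d)) :
    quad M (u - v) (u - v) = quad M u u - 2 * quad M u v + quad M v v := by
  have h := quad_comm hM u v
  simp only [quad, WithLp.ofLp_sub, Matrix.mulVec_sub, sub_dotProduct, dotProduct_sub] at h ⊢
  linarith

/-- The convexity gap with weights `s` and `t` equals `½ s t ‖x - y‖²_A`. -/
lemma convexOn_quad_sub {A : Matrix (Fin d) (Fin d) ℝ} (hA : A.PosSemidef)
    (c : EuclideanSpace ℝ (Fin d)) :
    ConvexOn ℝ Set.univ fun θ => 1 / 2 * quad A (θ - c) (θ - c) := by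
  refine ⟨convex_univ, fun x _ y _ s t hs ht hst => ?_⟩
  have hxy : 0 ≤ quad A (x - y) (x - y) := by
    simpa [quad] using hA.dotProduct_mulVec_nonneg (x - y).ofLp
  have e : s • x + t • y - c = s • (x - c) + t • (y - c) := by
    rw [smul_sub, smul_sub, sub_add_sub_comm, ← add_smul, hst, one_smul]
  have e2 : x - y = (x - c) - (y - c) := by abel
  rw [e2, quad_sub_self hA.1] at hxy
  simp only [e, smul_eq_mul]
  have h := quad_comm hA.1 (x - c) (y - c)
  have key : quad A (s • (x - c) + t • (y - c)) (s • (x - c) + t • (y - c))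
      = s ^ 2 * quad A (x - c) (x - c) + 2 * s * t * quad A (x - c) (y - c)
        + t ^ 2 * quad A (y - c) (y - c) := by
    generalize x - c = u at *
    generalize y - c = v at *
    simp only [quad, WithLp.ofLp_add, WithLp.ofLp_smul, Matrix.mulVec_add, Matrix.mulVec_smul,
      add_dotProduct, dotProduct_add, smul_dotProduct, dotProduct_smul, smul_eq_mul] at h ⊢
    linear_combination -(s * t) * h
  rw [key]
  obtain rfl : t = 1 - s := by linarith
  nlinarith [mul_nonneg (mul_nonneg hs ht) hxy]

/-- Existence of Lagrange multipliers for the minimization of a convex function over the part of a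
ball lying in an open half-space. -/
lemma exists_multipliers {f : EuclideanSpace ℝ (Fin d) → ℝ} (hf : ConvexOn ℝ Set.univ f)
    {R p : ℝ} (hR : 0 < R) {v : EuclideanSpace ℝ (Fin d)} (hv : v ≠ 0)
    (hp : ∀ θ, ‖θ‖ ≤ R → 0 < (inner ℝ θ v : ℝ) → p ≤ f θ) :
    ∃ γ μ : ℝ, 0 ≤ γ ∧ 0 ≤ μ ∧
      ∀ θ, p ≤ f θ + γ / 2 * (‖θ‖ ^ 2 - R ^ 2) - μ * inner ℝ θ v := by
  -- Triples strictly above the objective and the two constraint functions. The set is open and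
  -- convex and misses `(p, 0, 0)`, and the coefficients of a separating functional are the
  -- multipliers.
  let C : Set (ℝ × ℝ × ℝ) :=
    {z | ∃ θ, f θ < z.1 ∧ (‖θ‖ ^ 2 - R ^ 2) / 2 < z.2.1 ∧ -(inner ℝ θ v : ℝ) < z.2.2}
  have hCo : IsOpen C := by
    have : C = ⋃ θ, {z : ℝ × ℝ × ℝ | f θ < z.1 ∧ (‖θ‖ ^ 2 - R ^ 2) / 2 < z.2.1 ∧
        -(inner ℝ θ v : ℝ) < z.2.2} := by ext z; simp [C]
    rw [this]
    refine isOpen_iUnion fun θ => ?_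
    exact (isOpen_lt continuous_const continuous_fst).inter
      ((isOpen_lt continuous_const (continuous_fst.comp continuous_snd)).inter
        (isOpen_lt continuous_const (continuous_snd.comp continuous_snd)))
  have hCc : Convex ℝ C := by
    rintro z ⟨θ, h1, h2, h3⟩ z' ⟨θ', h1', h2', h3'⟩ s t hs ht hst
    have hsq : ConvexOn ℝ Set.univ fun θ : EuclideanSpace ℝ (Fin d) => ‖θ‖ ^ 2 :=
      convexOn_univ_norm.pow (fun _ _ => norm_nonneg _) 2
    have comb : ∀ {x x' y y' : ℝ}, x < y → x' < y' → s * x + t * x' < s * y + t * y' := by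
      intro x x' y y' h h'
      rcases hs.eq_or_lt with rfl | hs'
      · obtain rfl : t = 1 := by linarith
        simpa using h'
      · exact add_lt_add_of_lt_of_le (mul_lt_mul_of_pos_left h hs')
          (mul_le_mul_of_nonneg_left h'.le ht)
    refine ⟨s • θ + t • θ', ?_, ?_, ?_⟩
    · have := hf.2 (Set.mem_univ θ) (Set.mem_univ θ') hs ht hst
      exact this.trans_lt (by simpa using comb h1 h1')
    · have := hsq.2 (Set.mem_univ θ) (Set.mem_univ θ') hs ht hst
      have h4 := comb h2 h2'
      simp only [smul_eq_mul, Prod.snd_add, Prod.fst_add, Prod.smul_snd, Prod.smul_fst] at this ⊢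
      obtain rfl : t = 1 - s := by linarith
      linarith
    · have h4 := comb h3 h3'
      simp only [smul_eq_mul, Prod.snd_add, Prod.smul_snd, inner_add_left, inner_smul_left,
        RCLike.conj_to_real]
      linarith
  have hpC : ((p, 0, 0) : ℝ × ℝ × ℝ) ∉ C := by
    rintro ⟨θ, h1, h2, h3⟩
    simp only at h1 h2 h3
    have : ‖θ‖ < R := lt_of_pow_lt_pow_left₀ 2 hR.le (by linarith)
    exact absurd (hp θ this.le (by linarith)) (not_le.2 h1)
  obtain ⟨φ, hφ⟩ := geometric_hahn_banach_open_point hCc hCo hpC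
  obtain ⟨α, β, κ, hφe⟩ : ∃ α β κ : ℝ, ∀ x y z : ℝ, φ (x, y, z) = -(α * x + β * y + κ * z) := by
    refine ⟨-φ (1, 0, 0), -φ (0, 1, 0), -φ (0, 0, 1), fun x y z => ?_⟩
    have : ((x, y, z) : ℝ × ℝ × ℝ)
        = x • ((1, 0, 0) : ℝ × ℝ × ℝ) + y • ((0, 1, 0) : ℝ × ℝ × ℝ)
          + z • ((0, 0, 1) : ℝ × ℝ × ℝ) := by simp
    rw [this, map_add, map_add, map_smul, map_smul, map_smul]
    simp only [smul_eq_mul]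
    ring
  have hsep : ∀ θ x y z, f θ < x → (‖θ‖ ^ 2 - R ^ 2) / 2 < y → -(inner ℝ θ v : ℝ) < z →
      0 < α * (x - p) + β * y + κ * z := by
    intro θ x y z h1 h2 h3
    have := hφ (x, y, z) ⟨θ, h1, h2, h3⟩
    rw [hφe, hφe] at this
    linarith
  have hnonneg : ∀ D r : ℝ, (∀ t : ℝ, 0 ≤ t → 0 < D + r * t) → 0 ≤ r := by
    intro D r h
    by_contra! hr
    have h0 := h 0 le_rfl
    have h1 := h (D / -r) (div_nonneg (by linarith) (by linarith))
    have : r * (D / -r) = -D := by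
      rw [div_neg, mul_neg, mul_div_cancel₀ _ hr.ne]
    linarith
  have hR2 : 0 < R ^ 2 := by positivity
  have hbase : ∀ t₁ t₂ t₃ : ℝ, 0 ≤ t₁ → 0 ≤ t₂ → 0 ≤ t₃ →
      0 < α * (f 0 + 1 + t₁ - p) + β * (1 + t₂) + κ * (1 + t₃) := fun t₁ t₂ t₃ h1 h2 h3 =>
    hsep 0 _ _ _ (by linarith) (by simp; linarith) (by simp; linarith)
  have hα : 0 ≤ α := hnonneg (α * (f 0 + 1 - p) + β + κ) α fun t ht => by
    have := hbase t 0 0 ht le_rfl le_rfl; linarith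
  have hβ : 0 ≤ β := hnonneg (α * (f 0 + 1 - p) + β + κ) β fun t ht => by
    have := hbase 0 t 0 le_rfl ht le_rfl; linarith
  have hκ : 0 ≤ κ := hnonneg (α * (f 0 + 1 - p) + β + κ) κ fun t ht => by
    have := hbase 0 0 t le_rfl le_rfl ht; linarith
  -- Slater's condition: half the radius in the direction of `v` satisfies both constraints
  -- strictly, which rules out a functional with no weight on the objective.
  have hα' : 0 < α := by
    refine hα.lt_of_ne fun h0 => ?_
    have hnv : 0 < ‖v‖ := norm_pos_iff.2 hv
    have hn : ‖(R / (2 * ‖v‖)) • v‖ = R / 2 := by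
      rw [norm_smul, Real.norm_of_nonneg (by positivity)]; field_simp
    have hi : 0 < (inner ℝ ((R / (2 * ‖v‖)) • v) v : ℝ) := by
      rw [inner_smul_left, real_inner_self_eq_norm_sq]
      simp only [RCLike.conj_to_real]; positivity
    have := hsep ((R / (2 * ‖v‖)) • v) (f ((R / (2 * ‖v‖)) • v) + 1) 0 0 (by linarith)
      (by rw [hn]; nlinarith) (by linarith)
    rw [← h0] at this
    linarith
  refine ⟨β / α, κ / α, by positivity, by positivity, fun θ => ?_⟩
  have hlim : 0 ≤ α * (f θ - p) + β * ((‖θ‖ ^ 2 - R ^ 2) / 2) + κ * (-(inner ℝ θ v : ℝ)) := by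
    by_contra! hneg
    set D := α * (f θ - p) + β * ((‖θ‖ ^ 2 - R ^ 2) / 2) + κ * (-(inner ℝ θ v : ℝ))
    have hs : 0 < α + β + κ := by linarith
    have hε : 0 < -D / (α + β + κ) := div_pos (by linarith) hs
    -- The common slack at which the separating expression would vanish, against its strict
    -- positivity.
    set ε := -D / (α + β + κ) with hεd
    have h1 := hsep θ (f θ + ε) ((‖θ‖ ^ 2 - R ^ 2) / 2 + ε) (-(inner ℝ θ v : ℝ) + ε)
      (by linarith) (by linarith) (by linarith)
    have h2 : (α + β + κ) * ε = -D := by rw [hεd]; field_simp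
    simp only [D] at h2
    linarith
  have e : α * (f θ + β / α / 2 * (‖θ‖ ^ 2 - R ^ 2) - κ / α * inner ℝ θ v - p)
      = α * (f θ - p) + β * ((‖θ‖ ^ 2 - R ^ 2) / 2) + κ * (-(inner ℝ θ v : ℝ)) := by
    field_simp
    ring
  have := nonneg_of_mul_nonneg_right (e ▸ hlim) hα'
  linarith

/-- Completing the square in the Lagrangian. -/
lemma lagrangian_eq {A : Matrix (Fin d) (Fin d) ℝ} (hA : A.IsHermitian) {γ : ℝ}
    (hM : (A + γ • (1 : Matrix (Fin d) (Fin d) ℝ)).PosDef) (R μ : ℝ)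
    (θs v : EuclideanSpace ℝ (Fin d)) : ∃ θ₀ : EuclideanSpace ℝ (Fin d), ∀ θ,
    1 / 2 * quad A (θ - θs) (θ - θs) + γ / 2 * (‖θ‖ ^ 2 - R ^ 2) - μ * inner ℝ θ v
      = 1 / 2 * quad (A + γ • (1 : Matrix (Fin d) (Fin d) ℝ)) (θ - θ₀) (θ - θ₀)
        + (γ / 2 * (quad ((A + γ • (1 : Matrix (Fin d) (Fin d) ℝ))⁻¹ * A) θs θs - R ^ 2)
          - μ * quad ((A + γ • (1 : Matrix (Fin d) (Fin d) ℝ))⁻¹ * A) v θs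
          - μ ^ 2 / 2 * quad (A + γ • (1 : Matrix (Fin d) (Fin d) ℝ))⁻¹ v v) := by
  set M := A + γ • (1 : Matrix (Fin d) (Fin d) ℝ) with hMd
  have hdet : IsUnit M.det := (Matrix.isUnit_iff_isUnit_det M).1 hM.isUnit
  have hMN : M * M⁻¹ = 1 := Matrix.mul_nonsing_inv _ hdet
  have hMh : M.IsHermitian := hM.1
  have hNh : (M⁻¹).IsHermitian := hMh.inv
  have hAt : Aᵀ = A := by simpa [Matrix.IsSymm] using hA
  have hNt : (M⁻¹)ᵀ = M⁻¹ := by simpa [Matrix.IsSymm] using hNh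
  -- Stationarity of the Lagrangian in `θ` reads `M θ = r`, so the centre of the square is `M⁻¹ r`.
  set r : Fin d → ℝ := A *ᵥ θs.ofLp + μ • v.ofLp with hr
  refine ⟨WithLp.toLp 2 (M⁻¹ *ᵥ r), fun θ => ?_⟩
  have hsymA : ∀ x y : Fin d → ℝ, (A *ᵥ x) ⬝ᵥ y = x ⬝ᵥ (A *ᵥ y) := fun x y => by
    rw [Matrix.dotProduct_mulVec, ← Matrix.mulVec_transpose, hAt]
  have hsymN : ∀ x y : Fin d → ℝ, (M⁻¹ *ᵥ x) ⬝ᵥ y = x ⬝ᵥ (M⁻¹ *ᵥ y) := fun x y => by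
    rw [Matrix.dotProduct_mulVec, ← Matrix.mulVec_transpose, hNt]
  have hMθ : ∀ x : Fin d → ℝ, M *ᵥ x = A *ᵥ x + γ • x := fun x => by
    rw [hMd, Matrix.add_mulVec, Matrix.smul_mulVec, Matrix.one_mulVec]
  have hMr : M *ᵥ (M⁻¹ *ᵥ r) = r := by rw [Matrix.mulVec_mulVec, hMN, Matrix.one_mulVec]
  -- Substituting `A = M - γ I` removes the double occurrence of `A` and leaves the `γ / 2` term of
  -- `dualF`.
  have hANA : A *ᵥ (M⁻¹ *ᵥ (A *ᵥ θs.ofLp)) = A *ᵥ θs.ofLp - γ • (M⁻¹ *ᵥ (A *ᵥ θs.ofLp)) := by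
    have h := hMθ (M⁻¹ *ᵥ (A *ᵥ θs.ofLp))
    rw [Matrix.mulVec_mulVec, hMN, Matrix.one_mulVec] at h
    exact eq_sub_of_add_eq h.symm
  rw [quad_sub_self hA, quad_sub_self hMh, ← real_inner_self_eq_norm_sq, inner_eq_dotProduct,
    inner_eq_dotProduct]
  have h0 : (M⁻¹ *ᵥ r) ⬝ᵥ r = θs.ofLp ⬝ᵥ A *ᵥ θs.ofLp
      - γ * (θs.ofLp ⬝ᵥ M⁻¹ *ᵥ (A *ᵥ θs.ofLp))
      + 2 * μ * (v.ofLp ⬝ᵥ M⁻¹ *ᵥ (A *ᵥ θs.ofLp)) + μ ^ 2 * (v.ofLp ⬝ᵥ M⁻¹ *ᵥ v.ofLp) := by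
    have c1 : (A *ᵥ θs.ofLp) ⬝ᵥ (M⁻¹ *ᵥ v.ofLp) = v.ofLp ⬝ᵥ M⁻¹ *ᵥ (A *ᵥ θs.ofLp) := by
      rw [dotProduct_comm, hsymN]
    have c2 : (A *ᵥ θs.ofLp) ⬝ᵥ (M⁻¹ *ᵥ (A *ᵥ θs.ofLp)) = θs.ofLp ⬝ᵥ A *ᵥ θs.ofLp
        - γ * (θs.ofLp ⬝ᵥ M⁻¹ *ᵥ (A *ᵥ θs.ofLp)) := by
      rw [hsymA, hANA, dotProduct_sub, dotProduct_smul, smul_eq_mul]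
    rw [hsymN, hr]
    simp only [Matrix.mulVec_add, Matrix.mulVec_smul, add_dotProduct, dotProduct_add,
      smul_dotProduct, dotProduct_smul, smul_eq_mul, c1, c2]
    ring
  simp only [quad, hMr, hMθ θ.ofLp, ← Matrix.mulVec_mulVec, h0]
  rw [hr]
  simp only [dotProduct_add, dotProduct_smul, smul_eq_mul]
  ring

variable {X : Finset (EuclideanSpace ℝ (Fin d))}

lemma posDef_of_mem_multipliers {w : X → ℝ} (hw : ∀ x, 0 ≤ w x) {γ : ℝ}
    (hγ : γ ∈ multipliers X w) :
    (designMatrix X w + γ • (1 : Matrix (Fin d) (Fin d) ℝ)).PosDef :=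
  ((posSemidef_designMatrix X hw).add (Matrix.PosSemidef.one.smul hγ.1)).posDef_iff_isUnit.2 hγ.2

lemma mem_multipliers_of_pos {w : X → ℝ} (hw : ∀ x, 0 ≤ w x) {γ : ℝ} (hγ : 0 < γ) :
    γ ∈ multipliers X w :=
  ⟨hγ.le, (Matrix.PosDef.posSemidef_add (posSemidef_designMatrix X hw)
    (Matrix.PosDef.one.smul hγ)).isUnit⟩

lemma quad_neg_left (M : Matrix (Fin d) (Fin d) ℝ) (u v : EuclideanSpace ℝ (Fin d)) :
    quad M (-u) v = -quad M u v := by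
  simp [quad]

lemma quad_pos {M : Matrix (Fin d) (Fin d) ℝ} (hM : M.PosDef) {v : EuclideanSpace ℝ (Fin d)}
    (hv : v ≠ 0) : 0 < quad M v v := by
  have : v.ofLp ≠ 0 := by simpa using hv
  simpa [quad] using hM.dotProduct_mulVec_pos this

lemma quad_nonneg {M : Matrix (Fin d) (Fin d) ℝ} (hM : M.PosSemidef)
    (v : EuclideanSpace ℝ (Fin d)) : 0 ≤ quad M v v := by
  simpa [quad] using hM.dotProduct_mulVec_nonneg v.ofLp

/-- Weak duality. -/
lemma dualF_le {w : X → ℝ} (hw : ∀ x, 0 ≤ w x) {R γ : ℝ}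
    (hγ : γ ∈ multipliers X w) {θs xs x' θ : EuclideanSpace ℝ (Fin d)} (hθ : ‖θ‖ ≤ R)
    (hi : 0 < (inner ℝ θ (x' - xs) : ℝ)) :
    dualF X R θs xs w x' γ ≤ 1 / 2 * quad (designMatrix X w) (θ - θs) (θ - θs) := by
  have hA := posSemidef_designMatrix X hw
  have hM := posDef_of_mem_multipliers hw hγ
  have hv : x' - xs ≠ 0 := fun h => by simp [h] at hi
  have hq := quad_pos hM.inv hv
  simp only [dualF]
  rw [← neg_sub x' xs, quad_neg_left]
  set M := designMatrix X w + γ • (1 : Matrix (Fin d) (Fin d) ℝ)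
  set q := quad M⁻¹ (x' - xs) (x' - xs)
  set s := quad (M⁻¹ * designMatrix X w) (x' - xs) θs
  -- This `μ` maximizes `-μ s - μ² q / 2` over `μ ≥ 0`, with maximum `max (-s) 0 ^ 2 / (2 q)`.
  obtain ⟨θ₀, h⟩ := lagrangian_eq hA.1 hM R (max (-s) 0 / q) θs (x' - xs)
  have h1 := h θ
  have h2 := quad_nonneg hM.posSemidef (θ - θ₀)
  have h3 : 0 ≤ max (-s) 0 / q * inner ℝ θ (x' - xs) := by positivity
  have h4 : γ / 2 * (‖θ‖ ^ 2 - R ^ 2) ≤ 0 := by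
    have : ‖θ‖ ^ 2 ≤ R ^ 2 := by gcongr
    exact mul_nonpos_of_nonneg_of_nonpos (by linarith [hγ.1]) (by linarith)
  have h5 : -(max (-s) 0 / q * s) - (max (-s) 0 / q) ^ 2 / 2 * q = max (-s) 0 ^ 2 / (2 * q) := by
    have h6 : max (-s) 0 * s = -max (-s) 0 ^ 2 := by
      rcases le_total (-s) 0 with h | h
      · simp [max_eq_right h]
      · rw [max_eq_left h]; ring
    have : -(max (-s) 0 / q * s) - (max (-s) 0 / q) ^ 2 / 2 * q
        = -(max (-s) 0 * s) / q - max (-s) 0 ^ 2 / (2 * q) := by field_simp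
    rw [this, h6]
    field_simp
    ring
  change _ = 1 / 2 * quad M (θ - θ₀) (θ - θ₀) + (_ - max (-s) 0 / q * s
    - (max (-s) 0 / q) ^ 2 / 2 * q) at h1
  linarith

/-- Strong duality. -/
lemma le_iSup_dualF {w : X → ℝ} (hw : ∀ x, 0 ≤ w x) {R p : ℝ} (hR : 0 < R)
    {θs xs x' : EuclideanSpace ℝ (Fin d)} (hx : x' ≠ xs)
    (hp : ∀ θ, ‖θ‖ ≤ R → 0 < (inner ℝ θ (x' - xs) : ℝ) →
      p ≤ 1 / 2 * quad (designMatrix X w) (θ - θs) (θ - θs)) :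
    (p : EReal) ≤ ⨆ γ ∈ multipliers X w, (dualF X R θs xs w x' γ : EReal) := by
  have hA := posSemidef_designMatrix X hw
  have hv : x' - xs ≠ 0 := sub_ne_zero.2 hx
  obtain ⟨γ, μ, hγ, hμ, hL⟩ := exists_multipliers (convexOn_quad_sub hA θs) hR hv hp
  refine le_of_forall_lt fun c hc => ?_
  obtain ⟨r, hcr, hrp⟩ := EReal.lt_iff_exists_real_btwn.1 hc
  refine hcr.trans_le ?_
  have hrp' : r < p := by exact_mod_cast hrp
  -- The multiplier `γ` may be `0` while the design matrix is singular. Raising it by this amount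
  -- makes the matrix invertible and lowers the Lagrangian by at most `p - r`.
  have hε : 0 < 2 * (p - r) / R ^ 2 := div_pos (by linarith) (by positivity)
  have hm : γ + 2 * (p - r) / R ^ 2 ∈ multipliers X w :=
    mem_multipliers_of_pos hw (by linarith)
  refine le_trans ?_ (le_iSup₂_of_le _ hm le_rfl)
  rw [EReal.coe_le_coe_iff]
  set γ' := γ + 2 * (p - r) / R ^ 2 with hγ'
  have hM := posDef_of_mem_multipliers hw hm
  have hq := quad_pos hM.inv hv
  simp only [dualF]
  rw [← neg_sub x' xs, quad_neg_left]
  obtain ⟨θ₀, h⟩ := lagrangian_eq hA.1 hM R μ θs (x' - xs)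
  set M := designMatrix X w + γ' • (1 : Matrix (Fin d) (Fin d) ℝ)
  -- At the minimizer the square vanishes, so the Lagrangian bound becomes a bound on the remaining
  -- constant.
  have h1 := h θ₀
  set q := quad M⁻¹ (x' - xs) (x' - xs)
  set s := quad (M⁻¹ * designMatrix X w) (x' - xs) θs
  have h2 := hL θ₀
  have h3 : quad M (θ₀ - θ₀) (θ₀ - θ₀) = 0 := by simp [quad]
  rw [h3] at h1
  have h4 : γ' / 2 * (‖θ₀‖ ^ 2 - R ^ 2)
      = γ / 2 * (‖θ₀‖ ^ 2 - R ^ 2) + (p - r) / R ^ 2 * ‖θ₀‖ ^ 2 - (p - r) := by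
    rw [hγ']; field_simp; ring
  have h5 : 0 ≤ (p - r) / R ^ 2 * ‖θ₀‖ ^ 2 :=
    mul_nonneg (div_nonneg (by linarith) (by positivity)) (by positivity)
  have h6 : -(μ * s) - μ ^ 2 / 2 * q ≤ max (-s) 0 ^ 2 / (2 * q) := by
    have h7 : -(μ * s) ≤ μ * max (-s) 0 := by
      rw [← mul_neg]; exact mul_le_mul_of_nonneg_left (le_max_left _ _) hμ
    rw [le_div_iff₀ (by positivity)]
    nlinarith [sq_nonneg (max (-s) 0 - μ * q)]
  linarith

/-- The primal and the dual value of a design coincide. -/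
lemma coe_primalValue_eq_dualValue {w : X → ℝ} (hw : ∀ x, 0 ≤ w x) {R : ℝ} (hR : 0 < R)
    (θs xs : EuclideanSpace ℝ (Fin d)) :
    ((primalValue X R θs xs w : ℝ≥0∞) : EReal) = dualValue X R θs xs w := by
  apply le_antisymm
  · refine le_iInf₂ fun x' hx' => ?_
    have hle : ∀ θ, ‖θ‖ ≤ R → 0 < (inner ℝ θ (x' - xs) : ℝ) → primalValue X R θs xs w
        ≤ ENNReal.ofReal (1 / 2 * quad (designMatrix X w) (θ - θs) (θ - θs)) :=
      fun θ h1 h2 => iInf₂_le θ ⟨h1, x', hx'.1, hx'.2, h2⟩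
    -- The point of norm `R` in the direction `x' - xs` is an alternative, so the infimum is finite
    -- and can be treated as a real.
    have hfin : primalValue X R θs xs w ≠ ∞ := by
      have hnv : 0 < ‖x' - xs‖ := norm_pos_iff.2 (sub_ne_zero.2 hx'.2)
      refine ne_top_of_le_ne_top ENNReal.ofReal_ne_top (hle ((R / ‖x' - xs‖) • (x' - xs)) ?_ ?_)
      · rw [norm_smul, Real.norm_of_nonneg (by positivity)]
        exact (by field_simp : R / ‖x' - xs‖ * ‖x' - xs‖ = R).le
      · rw [inner_smul_left, real_inner_self_eq_norm_sq]
        simp only [RCLike.conj_to_real]; positivity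
    rw [← EReal.coe_toReal (x := ((primalValue X R θs xs w : ℝ≥0∞) : EReal)) (by simpa using hfin)
      (by simp), EReal.toReal_coe_ennreal]
    refine le_iSup_dualF hw hR hx'.2 fun θ h1 h2 => ?_
    exact ENNReal.toReal_le_of_le_ofReal
      (mul_nonneg (by norm_num) (quad_nonneg (posSemidef_designMatrix X hw) _)) (hle θ h1 h2)
  · have h : (dualValue X R θs xs w).toENNReal ≤ primalValue X R θs xs w := by
      refine le_iInf₂ fun θ hθ => ?_
      obtain ⟨h1, x', hx', hne, hi⟩ := hθ
      rw [← EReal.real_coe_toENNReal]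
      refine EReal.toENNReal_le_toENNReal ?_
      refine (iInf₂_le x' ⟨hx', hne⟩).trans (iSup₂_le fun γ hγ => ?_)
      exact EReal.coe_le_coe_iff.2 (dualF_le hw hγ h1 hi)
    calc dualValue X R θs xs w ≤ ((dualValue X R θs xs w).toENNReal : EReal) := by
          rw [EReal.coe_toENNReal_eq_max]; exact le_max_right _ _
      _ ≤ _ := EReal.coe_ennreal_le_coe_ennreal_iff.2 h

lemma isGreatest_primalValue (hX : X.Nonempty) (R : ℝ) (θs xs : EuclideanSpace ℝ (Fin d)) :
    IsGreatest (primalValue X R θs xs '' stdSimplex ℝ X) (charTime X R θs xs)⁻¹ := by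
  have husc : UpperSemicontinuousOn (primalValue X R θs xs) (stdSimplex ℝ X) := by
    refine upperSemicontinuousOn_biInf fun θ _ =>
      ContinuousOn.upperSemicontinuousOn (Continuous.continuousOn ?_)
    simp_rw [quad_designMatrix]
    refine ENNReal.continuous_ofReal.comp ?_
    fun_prop
  have hne : (stdSimplex ℝ X).Nonempty := by
    obtain ⟨x, hx⟩ := hX
    classical exact ⟨_, single_mem_stdSimplex ℝ ⟨x, hx⟩⟩
  obtain ⟨w, hw, hmax⟩ := husc.exists_isMaxOn hne (isCompact_stdSimplex ℝ X)
  have : (charTime X R θs xs)⁻¹ = primalValue X R θs xs w := by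
    rw [charTime, inv_inv]
    exact le_antisymm (iSup₂_le fun w' hw' => hmax hw') (le_iSup₂_of_le w hw le_rfl)
  rw [this]
  exact ⟨⟨w, hw, rfl⟩, by rintro _ ⟨w', hw', rfl⟩; exact hmax hw'⟩

lemma isGreatest_dualValue (hX : X.Nonempty) {R : ℝ} (hR : 0 < R)
    (θs xs : EuclideanSpace ℝ (Fin d)) :
    IsGreatest (dualValue X R θs xs '' stdSimplex ℝ X)
      (((charTime X R θs xs)⁻¹ : ℝ≥0∞) : EReal) := by
  obtain ⟨⟨w, hw, he⟩, hub⟩ := isGreatest_primalValue hX R θs xs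
  constructor
  · exact ⟨w, hw, by rw [← coe_primalValue_eq_dualValue hw.1 hR, he]⟩
  · rintro _ ⟨w', hw', rfl⟩
    rw [← coe_primalValue_eq_dualValue hw'.1 hR, EReal.coe_ennreal_le_coe_ennreal_iff]
    exact hub ⟨w', hw', rfl⟩

end Duality

/-! ### Parameters with a unique best arm are dense -/

section Density

variable {d : ℕ} {X : Finset (EuclideanSpace ℝ (Fin d))}

/-- Every nonempty open set contains a parameter that separates the arms. -/
lemma exists_separating_mem (X : Finset (EuclideanSpace ℝ (Fin d)))
    {U : Set (EuclideanSpace ℝ (Fin d))} (hU : IsOpen U) (hne : U.Nonempty) :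
    ∃ θ ∈ U, ∀ x ∈ X, ∀ y ∈ X, x ≠ y → (inner ℝ θ x : ℝ) ≠ inner ℝ θ y := by
  by_contra! hc
  -- Ties occur only on finitely many hyperplanes. These are Lebesgue-null, while a nonempty open
  -- set is not.
  have hsub : U ⊆ ⋃ p ∈ X.offDiag, (((ℝ ∙ (p.1 - p.2))ᗮ : Submodule ℝ (EuclideanSpace ℝ (Fin d))) :
      Set (EuclideanSpace ℝ (Fin d))) := by
    intro θ hθ
    obtain ⟨x, hx, y, hy, hxy, he⟩ := hc θ hθ
    simp only [Set.mem_iUnion, SetLike.mem_coe, Submodule.mem_orthogonal_singleton_iff_inner_left]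
    exact ⟨(x, y), Finset.mem_offDiag.2 ⟨hx, hy, hxy⟩, by rw [inner_sub_right, he, sub_self]⟩
  have h0 : volume (⋃ p ∈ X.offDiag, (((ℝ ∙ (p.1 - p.2))ᗮ : Submodule ℝ (EuclideanSpace ℝ (Fin d))) :
      Set (EuclideanSpace ℝ (Fin d)))) = 0 := by
    refine (measure_biUnion_null_iff X.offDiag.countable_toSet).2 fun p hp => ?_
    refine Measure.addHaar_submodule _ _ fun htop => ?_
    have hne : p.1 - p.2 ≠ 0 := sub_ne_zero.2 (Finset.mem_offDiag.1 hp).2.2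
    have : p.1 - p.2 ∈ (ℝ ∙ (p.1 - p.2))ᗮ := htop ▸ Submodule.mem_top
    rw [Submodule.mem_orthogonal_singleton_iff_inner_left] at this
    exact hne (inner_self_eq_zero.1 this)
  exact (hU.measure_pos volume hne).ne' (measure_mono_null hsub h0)

/-- Shrinking `θ` moves it into the open ball and keeps `x'` ahead of `xs`. Both conditions are
open, so a nearby separating parameter satisfies them, and its maximizer cannot be `xs`. -/
lemma exists_isUniqueBest_near {R : ℝ} (hR : 0 < R) {θ x' xs : EuclideanSpace ℝ (Fin d)}
    (hθ : ‖θ‖ ≤ R) (hx' : x' ∈ X) (hi : 0 < (inner ℝ θ (x' - xs) : ℝ)) {ε : ℝ} (hε : 0 < ε) :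
    ∃ θ' z, ‖θ'‖ ≤ R ∧ ‖θ' - θ‖ < ε ∧ z ≠ xs ∧ IsUniqueBest X θ' z := by
  let U : Set (EuclideanSpace ℝ (Fin d)) :=
    {θ' | ‖θ'‖ < R ∧ ‖θ' - θ‖ < ε ∧ 0 < (inner ℝ θ' (x' - xs) : ℝ)}
  have hU : IsOpen U :=
    (isOpen_lt continuous_norm continuous_const).inter
      ((isOpen_lt (continuous_id.sub continuous_const).norm continuous_const).inter
        (isOpen_lt continuous_const (Continuous.inner (𝕜 := ℝ) continuous_id continuous_const)))
  have hne : U.Nonempty := by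
    set t := ε / (2 * (R + ε)) with ht
    have ht0 : 0 < t := by positivity
    have ht1 : t < 1 := by rw [ht, div_lt_one (by positivity)]; linarith
    have htR : t * R < ε := by
      rw [ht, div_mul_eq_mul_div, div_lt_iff₀ (by positivity)]; nlinarith [mul_pos hε hR]
    refine ⟨(1 - t) • θ, ?_, ?_, ?_⟩
    · rw [norm_smul, Real.norm_of_nonneg (by linarith)]
      nlinarith [norm_nonneg θ]
    · rw [sub_smul, one_smul, sub_sub_cancel_left, norm_neg, norm_smul,
        Real.norm_of_nonneg ht0.le]
      exact (mul_le_mul_of_nonneg_left hθ ht0.le).trans_lt htR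
    · rw [inner_smul_left]
      exact mul_pos (by simpa using ht1) hi
  obtain ⟨θ', ⟨h1, h2, h3⟩, hsep⟩ := exists_separating_mem X hU hne
  obtain ⟨z, hz, hmax⟩ := X.exists_max_image (fun x => (inner ℝ θ' x : ℝ)) ⟨x', hx'⟩
  refine ⟨θ', z, h1.le, h2, ?_, hz, fun y hy hyz =>
    (hmax y hy).lt_of_ne (hsep y hy z hz hyz)⟩
  rintro rfl
  rw [inner_sub_right] at h3
  linarith [hmax x' hx']

/-- Close to a parameter under which `a` is not the unique best arm there is one under which
another arm is the unique best one. -/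
lemma exists_isUniqueBest_ne_near {R : ℝ} (hR : 0 < R) {θ a b : EuclideanSpace ℝ (Fin d)}
    (hθ : ‖θ‖ ≤ R) (hb : b ∈ X) (hab : b ≠ a) (hi : (inner ℝ θ a : ℝ) ≤ inner ℝ θ b)
    {ε : ℝ} (hε : 0 < ε) :
    ∃ θ' z, ‖θ'‖ ≤ R ∧ ‖θ' - θ‖ < ε ∧ z ≠ a ∧ IsUniqueBest X θ' z := by
  have hv : 0 < ‖b - a‖ := norm_pos_iff.2 (sub_ne_zero.2 hab)
  -- Moving from `θ` towards `u` stays in the ball and puts `b` strictly ahead of `a`. The step uses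
  -- less than `ε / 2`, and the other half is left for reaching a unique best arm.
  set u := (R / ‖b - a‖) • (b - a) with hu
  have hun : ‖u‖ = R := by
    rw [hu, norm_smul, Real.norm_of_nonneg (by positivity)]; field_simp
  have hui : 0 < (inner ℝ u (b - a) : ℝ) := by
    rw [hu, inner_smul_left, real_inner_self_eq_norm_sq]
    simp only [RCLike.conj_to_real]; positivity
  set t := ε / (4 * (R + ε)) with ht
  have ht0 : 0 < t := by positivity
  have ht1 : t < 1 := by rw [ht, div_lt_one (by positivity)]; linarith
  have htR : t * (2 * R) < ε / 2 := by
    rw [ht, div_mul_eq_mul_div, div_lt_iff₀ (by positivity)]; nlinarith [mul_pos hε hR]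
  have hn : ‖(1 - t) • θ + t • u‖ ≤ R := by
    refine (norm_add_le _ _).trans ?_
    rw [norm_smul, norm_smul, Real.norm_of_nonneg (by linarith), Real.norm_of_nonneg ht0.le, hun]
    nlinarith
  have hd : ‖(1 - t) • θ + t • u - θ‖ < ε / 2 := by
    have : (1 - t) • θ + t • u - θ = t • (u - θ) := by rw [sub_smul, one_smul, smul_sub]; abel
    rw [this, norm_smul, Real.norm_of_nonneg ht0.le]
    refine lt_of_le_of_lt (mul_le_mul_of_nonneg_left ?_ ht0.le) htR
    refine (norm_sub_le _ _).trans ?_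
    linarith
  have hpos : 0 < (inner ℝ ((1 - t) • θ + t • u) (b - a) : ℝ) := by
    rw [inner_add_left, inner_smul_left, inner_smul_left]
    simp only [RCLike.conj_to_real]
    have h1 : 0 ≤ (inner ℝ θ (b - a) : ℝ) := by rw [inner_sub_right]; linarith
    have h2 := mul_pos ht0 hui
    have h3 := mul_nonneg (by linarith : (0 : ℝ) ≤ 1 - t) h1
    linarith
  obtain ⟨θ', z, h1, h2, h3, h4⟩ := exists_isUniqueBest_near hR hn hb hpos (half_pos hε)
  refine ⟨θ', z, h1, ?_, h3, h4⟩
  have := norm_sub_le_norm_sub_add_norm_sub θ' ((1 - t) • θ + t • u) θ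
  linarith

end Density

/-! ### The lower bound -/

section LowerBound

variable {d : ℕ} {X : Finset (EuclideanSpace ℝ (Fin d))} {S : Type*} [MeasurableSpace S]

namespace Strategy

variable (a : Strategy X S)

/-- The event of stopping with an arm different from `z`. -/
def wrongEvent (θ z : EuclideanSpace ℝ (Fin d)) : Set (S × (ℕ → ℝ)) :=
  {ω | ∃ k : ℕ, a.stopTime θ ω = k ∧
    (a.answer k (ω.1, a.rewards θ ω k) : EuclideanSpace ℝ (Fin d)) ≠ z}

lemma measurable_stopTime (θ : EuclideanSpace ℝ (Fin d)) :
    Measurable fun ω => (a.stopTime θ ω : ℝ≥0∞) := by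
  simp_rw [ENat.toENNReal_eq_tsum]
  refine Measurable.tsum fun i => Measurable.ite ?_ measurable_const measurable_const
  have : {ω | (i : ℕ∞) < a.stopTime θ ω}
      = (driftData (a.meanDrift θ) i ⁻¹' a.haltedSet i)ᶜ := by
    ext ω
    simp [driftData_mem_haltedSet_iff]
  rw [this]
  exact (measurable_driftData (a.measurable_meanDrift θ) i (a.measurableSet_haltedSet i)).compl

/-- A finite mean makes the strategy stop almost surely, and whatever arm it returns differs from at
least one of `z` and `z'`. -/
lemma one_le_measureReal_wrongEvent (ν : Measure S) [IsProbabilityMeasure ν]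
    {θ z z' : EuclideanSpace ℝ (Fin d)} (hz : z ≠ z') (hfin : a.expectedSamples ν θ ≠ ∞) :
    1 ≤ (noiseLaw ν).real (a.wrongEvent θ z) + (noiseLaw ν).real (a.wrongEvent θ z') := by
  have hae : ∀ᵐ ω ∂(noiseLaw ν), ω ∈ a.wrongEvent θ z ∪ a.wrongEvent θ z' := by
    filter_upwards [ae_lt_top (a.measurable_stopTime θ) hfin] with ω hω
    have hne : a.stopTime θ ω ≠ ⊤ := fun h => by simp [h] at hω
    obtain ⟨k, hk⟩ := ENat.ne_top_iff_exists.1 hne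
    by_cases h : (a.answer k (ω.1, a.rewards θ ω k) : EuclideanSpace ℝ (Fin d)) = z
    · exact Or.inr ⟨k, hk.symm, h ▸ hz⟩
    · exact Or.inl ⟨k, hk.symm, h⟩
  have h1 : noiseLaw ν (a.wrongEvent θ z ∪ a.wrongEvent θ z') = 1 := by
    exact (measure_congr (eventuallyEq_univ.2 hae)).trans measure_univ
  calc (1 : ℝ) = (noiseLaw ν).real (a.wrongEvent θ z ∪ a.wrongEvent θ z') := by
        simp [Measure.real, h1]
    _ ≤ _ := measureReal_union_le _ _

/-- The information gathered under `θs` against `θ`. -/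
noncomputable def information (ν : Measure S) (θs θ : EuclideanSpace ℝ (Fin d)) : ℝ :=
  1 / 2 * ∑ x : X, (a.expectedPulls ν θs x).toReal
    * (inner ℝ (θ - θs) (x : EuclideanSpace ℝ (Fin d))) ^ 2

lemma continuous_information (ν : Measure S) (θs : EuclideanSpace ℝ (Fin d)) :
    Continuous (a.information ν θs) := by
  unfold information; fun_prop

lemma exists_information_lt (ν : Measure S) (θs θ : EuclideanSpace ℝ (Fin d)) {c : ℝ}
    (hc : a.information ν θs θ < c) :
    ∃ ε > 0, ∀ θ', ‖θ' - θ‖ < ε → a.information ν θs θ' < c := by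
  obtain ⟨ε, hε, h⟩ := Metric.eventually_nhds_iff.1
    ((a.continuous_information ν θs).continuousAt.eventually_lt_const hc)
  exact ⟨ε, hε, fun θ' hθ' => h (by rwa [dist_eq_norm])⟩

/-- Were the information smaller at `θ`, continuity would make it smaller at a nearby parameter with
a unique best arm `z ≠ xs`. There the transportation bound applies, since stopping with an arm other
than `z` has probability at least `1 - δ` under `θs`. -/
lemma le_information (ν : Measure S) [IsProbabilityMeasure ν] {R δ : ℝ} (hR : 0 < R)
    (hδ : 0 < δ) (hδ1 : δ < 1) (ha : a.IsDeltaCorrect ν R δ)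
    {θs xs : EuclideanSpace ℝ (Fin d)} (hθs : ‖θs‖ ≤ R) (hxs : IsUniqueBest X θs xs)
    (hfin : a.expectedSamples ν θs ≠ ∞) {θ : EuclideanSpace ℝ (Fin d)}
    (hθ : θ ∈ alternatives X R xs) :
    (1 - δ) * Real.log (1 / δ) - Real.log 2 ≤ a.information ν θs θ := by
  by_contra! hlt
  obtain ⟨ε, hε, hnear⟩ := a.exists_information_lt ν θs θ hlt
  obtain ⟨hn, x', hx', -, hi⟩ := hθ
  obtain ⟨θ', z, h1, h2, h3, h4⟩ := exists_isUniqueBest_near hR hn hx' hi hε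
  have h5 := hnear θ' h2
  have h6 := a.log_mul_stop_le ν hδ ha hfin h1 h4
  have h7 := a.one_le_measureReal_wrongEvent ν h3 hfin
  have h8 : (noiseLaw ν).real (a.wrongEvent θs xs) ≤ δ :=
    ENNReal.toReal_le_of_le_ofReal hδ.le (ha θs hθs xs hxs)
  have hL : 0 ≤ Real.log (1 / δ) := Real.log_nonneg ((one_le_div hδ).2 hδ1.le)
  have h9 : (1 - δ) * Real.log (1 / δ)
      ≤ Real.log (1 / δ) * (noiseLaw ν).real (a.wrongEvent θs z) := by
    rw [mul_comm]; exact mul_le_mul_of_nonneg_left (by linarith) hL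
  unfold information at h5
  unfold wrongEvent at h9
  linarith

lemma ofReal_le_expectedSamples_mul (ν : Measure S) [IsProbabilityMeasure ν]
    {R c : ℝ} {θs xs : EuclideanSpace ℝ (Fin d)}
    (hfin : a.expectedSamples ν θs ≠ ∞) (hne : (alternatives X R xs).Nonempty)
    (hc : ∀ θ ∈ alternatives X R xs, c ≤ a.information ν θs θ) :
    ENNReal.ofReal c ≤ a.expectedSamples ν θs * (charTime X R θs xs)⁻¹ := by
  have hsum := a.sum_expectedPulls ν θs
  have hN : ∀ x, a.expectedPulls ν θs x ≠ ∞ := by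
    rw [← hsum] at hfin
    simpa using ENNReal.sum_ne_top.1 hfin
  by_cases h0 : a.expectedSamples ν θs = 0
  -- Without samples there is nothing to normalize; but then no information is gathered, so `c ≤ 0`.
  · obtain ⟨θ, hθ⟩ := hne
    have h1 : ∀ x, a.expectedPulls ν θs x = 0 := by
      rw [h0] at hsum
      simpa using hsum
    have h2 := hc θ hθ
    simp only [information, h1, ENNReal.toReal_zero, zero_mul, Finset.sum_const_zero,
      mul_zero] at h2
    simp [ENNReal.ofReal_of_nonpos h2]
  set T := (a.expectedSamples ν θs).toReal with hT
  have hTpos : 0 < T := ENNReal.toReal_pos h0 hfin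
  have hTs : ∑ x, (a.expectedPulls ν θs x).toReal = T := by
    rw [hT, ← hsum, ENNReal.toReal_sum fun x _ => hN x]
  -- The design played on average: its value multiplied by `T` is the information gathered.
  let w : X → ℝ := fun x => (a.expectedPulls ν θs x).toReal / T
  have hw : w ∈ stdSimplex ℝ X :=
    ⟨fun x => by positivity, by simp only [w]; rw [← Finset.sum_div, hTs, div_self hTpos.ne']⟩
  have hprimal : ENNReal.ofReal c / a.expectedSamples ν θs ≤ primalValue X R θs xs w := by
    refine le_iInf₂ fun θ hθ => ?_
    rw [ENNReal.div_le_iff h0 hfin, ← ENNReal.ofReal_toReal hfin, mul_comm,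
      ← ENNReal.ofReal_mul hTpos.le]
    refine ENNReal.ofReal_le_ofReal ((hc θ hθ).trans_eq ?_)
    rw [quad_designMatrix, information]
    simp only [Finset.mul_sum]
    refine Finset.sum_congr rfl fun x _ => ?_
    simp only [w]
    field_simp
  have hchar : primalValue X R θs xs w ≤ (charTime X R θs xs)⁻¹ := by
    rw [charTime, inv_inv]
    exact le_iSup₂_of_le w hw le_rfl
  have := hprimal.trans hchar
  rwa [ENNReal.div_le_iff h0 hfin, mul_comm] at this

lemma charTime_mul_le_expectedSamples (ν : Measure S) [IsProbabilityMeasure ν] {R δ : ℝ}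
    (hR : 0 < R) (hδ : 0 < δ) (hδ1 : δ < 1) (ha : a.IsDeltaCorrect ν R δ)
    {θs xs : EuclideanSpace ℝ (Fin d)} (hθs : ‖θs‖ ≤ R) (hxs : IsUniqueBest X θs xs) :
    charTime X R θs xs * ENNReal.ofReal ((1 - δ) * Real.log (1 / δ) - Real.log 2)
      ≤ a.expectedSamples ν θs := by
  by_cases hfin : a.expectedSamples ν θs = ∞
  · simp [hfin]
  by_cases hne : (alternatives X R xs).Nonempty
  · calc _ ≤ charTime X R θs xs * (a.expectedSamples ν θs * (charTime X R θs xs)⁻¹) := by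
          gcongr
          exact a.ofReal_le_expectedSamples_mul ν hfin hne fun θ hθ =>
            a.le_information ν hR hδ hδ1 ha hθs hxs hfin hθ
      _ = a.expectedSamples ν θs * (charTime X R θs xs * (charTime X R θs xs)⁻¹) := by ring
      -- Only the inequality is available, since the characteristic time may be `0` or `∞`.
      _ ≤ a.expectedSamples ν θs * 1 := by gcongr; exact ENNReal.mul_inv_le_one _
      _ = _ := mul_one _
  · have h0 : charTime X R θs xs = 0 := by
      classical
      rw [charTime, ENNReal.inv_eq_zero, eq_top_iff]
      refine le_iSup₂_of_le _ (single_mem_stdSimplex ℝ (⟨xs, hxs.1⟩ : X)) ?_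
      exact le_iInf₂ fun θ hθ => absurd ⟨θ, hθ⟩ hne
    simp [h0]

/-- Without a unique best arm, no strategy can stop in finite expected time when `δ` is small. -/
lemma expectedSamples_eq_top (ν : Measure S) [IsProbabilityMeasure ν] {R δ : ℝ}
    (hR : 0 < R) (hδ : 0 < δ) (hL : 4 * Real.log 2 < Real.log (1 / δ))
    (ha : a.IsDeltaCorrect ν R δ) {θs xs b : EuclideanSpace ℝ (Fin d)} (hθs : ‖θs‖ ≤ R)
    (hxs : xs ∈ X) (hbest : ∀ x ∈ X, (inner ℝ θs x : ℝ) ≤ inner ℝ θs xs) (hb : b ∈ X)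
    (hbx : b ≠ xs) (htie : (inner ℝ θs xs : ℝ) ≤ inner ℝ θs b) :
    a.expectedSamples ν θs = ∞ := by
  by_contra hfin
  have h2 : 0 < Real.log 2 := Real.log_pos one_lt_two
  -- Both perturbed parameters will carry information below `log 2`. Each transportation bound is
  -- then below `2 log 2`, and since the two error probabilities sum to at least `1`, `log (1 / δ) <
  -- 4 log 2`.
  obtain ⟨ε, hε, hnear⟩ := a.exists_information_lt ν θs θs (c := Real.log 2)
    (by simpa [information] using h2)
  obtain ⟨θ₁, z₁, hθ₁, hd₁, hz₁, hu₁⟩ := exists_isUniqueBest_ne_near hR hθs hb hbx htie hε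
  obtain ⟨θ₂, z₂, hθ₂, hd₂, hz₂, hu₂⟩ :=
    -- Under `θs` the arm `xs` is at least as good as `z₁`, so another small perturbation gives a
    -- unique best arm different from `z₁`.
    exists_isUniqueBest_ne_near hR hθs hxs hz₁.symm (hbest z₁ hu₁.1) hε
  have h3 := a.log_mul_stop_le ν hδ ha hfin hθ₁ hu₁
  have h4 := a.log_mul_stop_le ν hδ ha hfin hθ₂ hu₂
  have h5 := hnear θ₁ hd₁
  have h6 := hnear θ₂ hd₂
  have h7 := mul_le_mul_of_nonneg_left (a.one_le_measureReal_wrongEvent ν hz₂ hfin)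
    (by linarith : 0 ≤ Real.log (1 / δ))
  unfold information at h5 h6
  unfold wrongEvent at h7
  linarith

end Strategy

lemma tendsto_log_one_div_nhdsGT_zero :
    Tendsto (fun δ : ℝ => Real.log (1 / δ)) (𝓝[>] 0) atTop := by
  simpa [Real.log_inv] using Real.tendsto_log_nhdsGT_zero

lemma charTime_le_liminf (ν : Measure S) [IsProbabilityMeasure ν] {R : ℝ} (hR : 0 < R)
    {θs xs : EuclideanSpace ℝ (Fin d)} (hθs : ‖θs‖ ≤ R) (hxs : xs ∈ X)
    (hbest : ∀ x ∈ X, (inner ℝ θs x : ℝ) ≤ inner ℝ θs xs) (alg : ℝ → Strategy X S)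
    (halg : ∀ δ : ℝ, 0 < δ → δ < 1 → (alg δ).IsDeltaCorrect ν R δ) :
    charTime X R θs xs ≤
      liminf (fun δ : ℝ => (alg δ).expectedSamples ν θs / ENNReal.ofReal (Real.log (1 / δ)))
        (𝓝[>] 0) := by
  have hsmall : ∀ᶠ δ : ℝ in 𝓝[>] 0, δ ∈ Set.Ioo (0 : ℝ) 1 := Ioo_mem_nhdsGT one_pos
  have hlog := tendsto_log_one_div_nhdsGT_zero
  by_cases hu : IsUniqueBest X θs xs
  -- Dividing the bound at fixed `δ` by `log (1 / δ)` gives this factor, which tends to `1`. The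
  -- product converges even if the characteristic time is infinite, because the limit of the factor
  -- is nonzero.
  · have hlim : Tendsto (fun δ : ℝ => charTime X R θs xs
        * ENNReal.ofReal ((1 - δ) - Real.log 2 / Real.log (1 / δ))) (𝓝[>] 0)
        (𝓝 (charTime X R θs xs)) := by
      have h1 : Tendsto (fun δ : ℝ => (1 - δ) - Real.log 2 / Real.log (1 / δ)) (𝓝[>] 0)
          (𝓝 ((1 - 0) - 0)) :=
        (tendsto_const_nhds.sub (tendsto_nhdsWithin_of_tendsto_nhds tendsto_id)).sub
          (hlog.const_div_atTop _)
      have h2 := ENNReal.Tendsto.const_mul (a := charTime X R θs xs)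
        (ENNReal.tendsto_ofReal h1) (Or.inl (by simp))
      simpa using h2
    rw [← hlim.liminf_eq]
    refine liminf_le_liminf ?_
    filter_upwards [hsmall, hlog.eventually_gt_atTop 0] with δ hδ hL
    rw [ENNReal.le_div_iff_mul_le (Or.inl (by simpa using hL)) (Or.inl ENNReal.ofReal_ne_top),
      mul_assoc, ← ENNReal.ofReal_mul' hL.le, sub_mul, div_mul_cancel₀ _ hL.ne']
    exact (alg δ).charTime_mul_le_expectedSamples ν hR hδ.1 hδ.2 (halg δ hδ.1 hδ.2) hθs hu
  · obtain ⟨b, hb, hbx, htie⟩ : ∃ b ∈ X, b ≠ xs ∧ (inner ℝ θs xs : ℝ) ≤ inner ℝ θs b := by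
      by_contra! hc
      exact hu ⟨hxs, hc⟩
    refine le_liminf_of_le (by isBoundedDefault) ?_
    filter_upwards [hsmall, hlog.eventually_gt_atTop (4 * Real.log 2)] with δ hδ hL
    rw [(alg δ).expectedSamples_eq_top ν hR hδ.1 hL (halg δ hδ.1 hδ.2) hθs hxs hbest hb hbx htie,
      ENNReal.top_div_of_ne_top ENNReal.ofReal_ne_top]
    exact le_top

end LowerBound

end LinBandit

theorem mainTheorem9 {d : ℕ} (X : Finset (EuclideanSpace ℝ (Fin d))) (R : ℝ) (hR : 0 < R)
    (θs : EuclideanSpace ℝ (Fin d)) (hθs : ‖θs‖ ≤ R)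
    (xs : EuclideanSpace ℝ (Fin d)) (hxs : xs ∈ X)
    (hbest : ∀ x ∈ X, (inner ℝ θs x : ℝ) ≤ inner ℝ θs xs) :
    IsGreatest (LinBandit.primalValue X R θs xs '' stdSimplex ℝ X)
        (LinBandit.charTime X R θs xs)⁻¹ ∧
      IsGreatest (LinBandit.dualValue X R θs xs '' stdSimplex ℝ X)
        (((LinBandit.charTime X R θs xs)⁻¹ : ℝ≥0∞) : EReal) ∧
      ∀ (S : Type*) [MeasurableSpace S] (ν : Measure S) [IsProbabilityMeasure ν]
        (alg : ℝ → LinBandit.Strategy X S),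
        (∀ δ : ℝ, 0 < δ → δ < 1 → (alg δ).IsDeltaCorrect ν R δ) →
        LinBandit.charTime X R θs xs ≤
          liminf (fun δ : ℝ => (alg δ).expectedSamples ν θs / ENNReal.ofReal (Real.log (1 / δ)))
            (𝓝[>] 0) := by
  exact ⟨LinBandit.isGreatest_primalValue ⟨xs, hxs⟩ R θs xs,
    LinBandit.isGreatest_dualValue ⟨xs, hxs⟩ hR θs xs, fun S _ ν _ alg halg =>
      LinBandit.charTime_le_liminf ν hR hθs hxs hbest alg halg⟩
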